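/- Let $R\in M_d(\mathbb Z)$ be expansive (all complex eigenvalues of modulus $>1$) and let $B\subset\mathbb Z^d$ be a non-empty finite set, $N=\#B$, whose distinct elements are incongruent modulo $R\mathbb Z^d$. Let $\mu=\mu(R,B)$ be the self-affine measure, i.e. the unique Borel probability measure on $\mathbb R^d$ with $\mu(E)=\frac1N\sum_{b\in B}\mu(\tau_b^{-1}E)$ for all Borel $E$, where $\tau_b(x)=R^{-1}(x+b)$, and let $\widehat\mu(\xi)=\int e^{-2\pi i\langle\xi,x\rangle}d\mu(x)$. For $n\ge 1$ put $B_n=B+RB+\dots+R^{n-1}B$. Let $0\le\epsilon_k<1$ $(k\ge1)$ with $\sum_k\epsilon_k<\infty$, let $n_k\ge1$ be integers, and let $J_{n_k}\subset\mathbb Z^d$ be finite sets with $0\in J_{n_k}$ such that for all $k$ and all $(w_b)_{b\in B_{n_k}}\in\mathbb C^{B_{n_k}}$ $$(1-\epsilon_k)\sum_{b\in B_{n_k}}|w_b|^2\le\sum_{\lambda\in J_{n_k}}\Big|\frac1{\sqrt{N^{n_k}}}\sum_{b\in B_{n_k}}w_be^{-2\pi i\langle R^{-n_k}b,\lambda\rangle}\Big|^2\le(1+\epsilon_k)\sum_{b\in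 B_{n_k}}|w_b|^2 .$$ (The set $J_{n_k}$ may depend on $k$, not only on the value of $n_k$.) Put $m_k=n_1+\dots+n_k$ (with $m_0=0$), $$\Lambda_k=J_{n_1}+(R^T)^{m_1}J_{n_2}+\dots+(R^T)^{m_{k-1}}J_{n_k},\qquad \Lambda=\bigcup_{k\ge1}\Lambda_k,\qquad \delta(\Lambda)=\inf_{k\ge1}\inf_{\lambda\in\Lambda_k}\big|\widehat\mu\big((R^T)^{-m_k}\lambda\big)\big|^2 .$$ If $\delta(\Lambda)>0$, then $E(\Lambda)=\{e^{2\pi i\langle\lambda,x\rangle}:\lambda\in\Lambda\}$ is a Fourier frame for $L^2(\mu)$ with lower frame bound $\prod_{j\ge1}(1-\epsilon_j)$ and upper frame bound $\prod_{j\ge1}(1+\epsilon_j)$: both products converge, the first is positive, and for every $f\in L^2(\mu)$ $$\prod_{j=1}^\infty(1-\epsilon_j)\,\|f\|^2\le\sum_{\lambda\in\Lambda}\Big|\int f(x)e^{-2\pi i\langle\lambda,x\rangle}d\mu(x)\Big|^2\le\prod_{j=1}^\infty(1+\epsilon_j)\,\|f\|^2 .$$ In particular, if all $\epsilon_j=0$,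 then $E(\Lambda)$ is a tight frame with bound $1$, i.e. $\sum_{\lambda\in\Lambda}\big|\int f(x)e^{-2\pi i\langle\lambda,x\rangle}d\mu(x)\big|^2=\|f\|^2$ for all $f\in L^2(\mu)$, and $\Lambda$ is a spectrum for $\mu$: the exponentials $e^{2\pi i\langle\lambda,x\rangle}$, $\lambda\in\Lambda$, form an orthonormal basis of $L^2(\mu)$. -/

import Mathlib

open MeasureTheory Filter Topology
open scoped Pointwise ENNReal NNReal

/-! ### Expansive integer matrices and digit sets -/

/-- An integer matrix is expansive if all its complex eigenvalues have modulus `> 1`. -/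
def IsExpansive {d : ℕ} (R : Matrix (Fin d) (Fin d) ℤ) : Prop :=
  ∀ z : ℂ, Module.End.HasEigenvalue (Matrix.toLin' (R.map (Int.cast : ℤ → ℂ))) z → 1 < ‖z‖

/-- The integer matrix `R`, with real entries. -/
def realMat {d : ℕ} (R : Matrix (Fin d) (Fin d) ℤ) : Matrix (Fin d) (Fin d) ℝ :=
  R.map (Int.cast : ℤ → ℝ)

/-- The integer vector `v`, as a point of Euclidean space. -/
def toVec {d : ℕ} (v : Fin d → ℤ) : EuclideanSpace ℝ (Fin d) :=
  WithLp.toLp 2 (fun i => (v i : ℝ))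

/-- The linear map `R⁻¹` on Euclidean space. -/
noncomputable def invMap {d : ℕ} (R : Matrix (Fin d) (Fin d) ℤ) :
    EuclideanSpace ℝ (Fin d) →L[ℝ] EuclideanSpace ℝ (Fin d) :=
  Matrix.toEuclideanCLM (𝕜 := ℝ) (realMat R)⁻¹

/-- The linear map `(Rᵀ)⁻¹` on Euclidean space. -/
noncomputable def invTransposeMap {d : ℕ} (R : Matrix (Fin d) (Fin d) ℤ) :
    EuclideanSpace ℝ (Fin d) →L[ℝ] EuclideanSpace ℝ (Fin d) :=
  Matrix.toEuclideanCLM (𝕜 := ℝ) ((realMat R).transpose)⁻¹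

/-- `B` is a simple digit set for `R`: distinct elements of `B` are incongruent modulo `R ℤ^d`. -/
def IsSimpleDigitSet {d : ℕ} (R : Matrix (Fin d) (Fin d) ℤ) (B : Finset (Fin d → ℤ)) : Prop :=
  ∀ b ∈ B, ∀ b' ∈ B, (∃ k : Fin d → ℤ, b - b' = R.mulVec k) → b = b'

/-- `B_n = B + R B + ⋯ + R^(n-1) B` (Minkowski sum of sets). -/
def digitSet {d : ℕ} (R : Matrix (Fin d) (Fin d) ℤ) (B : Finset (Fin d → ℤ)) (n : ℕ) :
    Finset (Fin d → ℤ) :=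
  ∑ j ∈ Finset.range n, B.image (fun b => (R ^ j).mulVec b)

/-! ### The self-affine measure -/

/-- The maps `τ_b(x) = R⁻¹ (x + b)` of the iterated function system. -/
noncomputable def ifsMap {d : ℕ} (R : Matrix (Fin d) (Fin d) ℤ) (b : Fin d → ℤ)
    (x : EuclideanSpace ℝ (Fin d)) : EuclideanSpace ℝ (Fin d) :=
  invMap R (x + toVec b)

/-- `μ` is a Borel probability measure with `μ(E) = ∑_{b ∈ B} (1/N) μ(τ_b⁻¹ E)` for all Borel
sets `E`, where `N = #B`. -/
structure IsSelfAffineMeasure {d : ℕ} (R : Matrix (Fin d) (Fin d) ℤ) (B : Finset (Fin d → ℤ))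
    (μ : Measure (EuclideanSpace ℝ (Fin d))) : Prop where
  isProbabilityMeasure : IsProbabilityMeasure μ
  invariant : ∀ E : Set (EuclideanSpace ℝ (Fin d)), MeasurableSet E →
    μ E = ∑ b ∈ B, (B.card : ℝ≥0∞)⁻¹ * μ (ifsMap R b ⁻¹' E)

section Existence

open Matrix.Norms.L2Operator in
theorem summable_norm_pow_of_spectrum {d : ℕ} (A : Matrix (Fin d) (Fin d) ℂ)
    (hA : ∀ z ∈ spectrum ℂ A, ‖z‖ < 1) : Summable (fun k : ℕ => ‖A ^ k‖) := by
  rcases subsingleton_or_nontrivial (Matrix (Fin d) (Fin d) ℂ) with hs | hn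
  · have : (fun k : ℕ => ‖A ^ k‖) = fun _ => 0 := by
      funext k
      rw [Subsingleton.elim (A ^ k) 0, norm_zero]
    rw [this]
    exact summable_zero
  · have h1 : spectralRadius ℂ A < ((1 : ℝ≥0) : ℝ≥0∞) :=
      spectrum.spectralRadius_lt_of_forall_lt A (fun z hz => by exact_mod_cast hA z hz)
    obtain ⟨r, hr1, hr2⟩ := ENNReal.lt_iff_exists_nnreal_btwn.1 h1
    have h2 := (spectrum.pow_nnnorm_pow_one_div_tendsto_nhds_spectralRadius A).eventually_lt_const
      hr1
    have hr : (r : ℝ) < 1 := by exact_mod_cast hr2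
    refine summable_of_isBigO_nat (summable_geometric_of_lt_one r.2 hr)
      (Asymptotics.IsBigO.of_bound 1 ?_)
    filter_upwards [h2, eventually_gt_atTop 0] with n hn hn0
    have hn' : (0 : ℝ) < n := by exact_mod_cast hn0
    have h3 : (‖A ^ n‖₊ : ℝ≥0∞) ≤ (r : ℝ≥0∞) ^ n := by
      have := ENNReal.rpow_le_rpow hn.le hn'.le
      rwa [← ENNReal.rpow_mul, one_div, inv_mul_cancel₀ hn'.ne', ENNReal.rpow_one,
        ENNReal.rpow_natCast] at this
    have h4 : ‖A ^ n‖₊ ≤ r ^ n := by exact_mod_cast h3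
    have h5 : ‖A ^ n‖ ≤ (r : ℝ) ^ n := by exact_mod_cast h4
    simpa using h5

theorem IsExpansive.isUnit_det {d : ℕ} {R : Matrix (Fin d) (Fin d) ℤ} (hR : IsExpansive R) :
    R.det ≠ 0 := by
  intro h0
  have h1 : (R.map (Int.cast : ℤ → ℂ)).det = 0 := by
    have := (Int.castRingHom ℂ).map_det R
    simp only [h0, map_zero] at this
    exact this.symm
  have h2 : (0 : ℂ) ∈ spectrum ℂ (R.map (Int.cast : ℤ → ℂ)) := by
    rw [spectrum.zero_mem_iff, Matrix.isUnit_iff_isUnit_det, h1]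
    simp
  rw [← Matrix.spectrum_toLin', ← Module.End.hasEigenvalue_iff_mem_spectrum] at h2
  have := hR 0 h2
  simp at this
  linarith

theorem IsExpansive.summable_norm_invMap_pow {d : ℕ} {R : Matrix (Fin d) (Fin d) ℤ}
    (hR : IsExpansive R) : Summable (fun k : ℕ => ‖invMap R ^ k‖) := by
  set C : Matrix (Fin d) (Fin d) ℂ := R.map (Int.cast : ℤ → ℂ) with hC
  have hCdet : IsUnit C.det := by
    have := (Int.castRingHom ℂ).map_det R
    have h2 : C.det = ((R.det : ℤ) : ℂ) := this.symm
    rw [h2, isUnit_iff_ne_zero]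
    exact_mod_cast hR.isUnit_det
  have hRdet : IsUnit (realMat R).det := by
    have := (Int.castRingHom ℝ).map_det R
    have h2 : (realMat R).det = ((R.det : ℤ) : ℝ) := this.symm
    rw [h2, isUnit_iff_ne_zero]
    exact_mod_cast hR.isUnit_det
  have hspec : ∀ z ∈ spectrum ℂ C⁻¹, ‖z‖ < 1 := by
    intro z hz
    have hz0 : z ≠ 0 := by
      rintro rfl
      rw [spectrum.zero_mem_iff] at hz
      exact hz ((Matrix.isUnit_nonsing_inv_iff).2 ((Matrix.isUnit_iff_isUnit_det C).2 hCdet))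
    set u : (Matrix (Fin d) (Fin d) ℂ)ˣ := Matrix.nonsingInvUnit C hCdet
    have hz' : (z⁻¹)⁻¹ ∈ spectrum ℂ (↑u⁻¹ : Matrix (Fin d) (Fin d) ℂ) := by
      rw [inv_inv]; exact hz
    rw [spectrum.inv₀_mem_inv_iff] at hz'
    have h3 : z⁻¹ ∈ spectrum ℂ C := hz'
    rw [← Matrix.spectrum_toLin', ← Module.End.hasEigenvalue_iff_mem_spectrum] at h3
    have h4 := hR _ h3
    rw [norm_inv] at h4
    exact (one_lt_inv_iff₀.1 h4).2
  have hmap : ∀ k : ℕ, (C⁻¹ ^ k) = ((realMat R)⁻¹ ^ k).map (algebraMap ℝ ℂ) := by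
    intro k
    have hinv : C⁻¹ = ((realMat R)⁻¹).map (algebraMap ℝ ℂ) := by
      refine Matrix.inv_eq_left_inv ?_
      have hCR : C = (realMat R).map (algebraMap ℝ ℂ) := by
        ext i j; simp [hC, realMat]
      rw [hCR, ← Matrix.map_mul, Matrix.nonsing_inv_mul _ hRdet]
      simp
    rw [hinv]
    exact (map_pow (algebraMap ℝ ℂ).mapMatrix _ k).symm
  open Matrix.Norms.L2Operator in
  let L : Matrix (Fin d) (Fin d) ℂ →ₗ[ℝ]
      (EuclideanSpace ℝ (Fin d) →L[ℝ] EuclideanSpace ℝ (Fin d)) :=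
    { toFun := fun A => Matrix.toEuclideanCLM (𝕜 := ℝ) (A.map Complex.re)
      map_add' := fun A A' => by
        rw [← map_add]; congr 1
      map_smul' := fun c A => by
        simp only [RingHom.id_apply]
        rw [← map_smul]; congr 1; ext i j; simp }
  open Matrix.Norms.L2Operator in
  have hbound : ∃ K : ℝ, ∀ A : Matrix (Fin d) (Fin d) ℂ, ‖L A‖ ≤ K * ‖A‖ :=
    ⟨‖LinearMap.toContinuousLinearMap L‖,
      fun A => (LinearMap.toContinuousLinearMap L).le_opNorm A⟩
  obtain ⟨K, hK⟩ := hbound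
  refine Summable.of_nonneg_of_le (fun _ => norm_nonneg _) (fun k => ?_)
    ((summable_norm_pow_of_spectrum C⁻¹ hspec).mul_left K)
  have hk := hK (C⁻¹ ^ k)
  have hL : L (C⁻¹ ^ k) = invMap R ^ k := by
    change Matrix.toEuclideanCLM (𝕜 := ℝ) ((C⁻¹ ^ k).map Complex.re) = _
    rw [invMap, ← map_pow, hmap k]
    congr 1
  rwa [hL] at hk

/-- The product of uniform measures is invariant under random choice of a new first letter. -/
theorem infinitePi_eq_sum_cons {ι : Type*} [Fintype ι] [MeasurableSpace ι] (p : Measure ι)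
    [IsProbabilityMeasure p] (c : ℝ≥0∞)
    (hp : ∀ t : Set ι, MeasurableSet t → p t = ∑ b : ι, c * Set.indicator t (fun _ => 1) b)
    (hcons : ∀ b : ι, Measurable (fun (ω : ℕ → ι) (k : ℕ) => Nat.casesOn (motive := fun _ => ι)
      k b ω)) :
    ∑ b : ι, c • (Measure.infinitePi (fun _ : ℕ => p)).map
      (fun (ω : ℕ → ι) (k : ℕ) => Nat.casesOn (motive := fun _ => ι) k b ω)
      = Measure.infinitePi (fun _ : ℕ => p) := by
  classical
  refine Measure.eq_infinitePi _ (fun s t ht => ?_)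
  have hmeas : MeasurableSet ((s : Set ℕ).pi t) :=
    MeasurableSet.pi s.countable_toSet (fun i _ => ht i)
  set s' : Finset ℕ := (s.erase 0).image Nat.pred with hs'
  have hmem : ∀ k, k ∈ s' ↔ k + 1 ∈ s := by
    intro k
    simp only [hs', Finset.mem_image, Finset.mem_erase]
    constructor
    · rintro ⟨a, ⟨ha0, ha⟩, rfl⟩
      obtain ⟨m, rfl⟩ := Nat.exists_eq_succ_of_ne_zero ha0
      simpa using ha
    · intro h
      exact ⟨k + 1, ⟨by omega, h⟩, rfl⟩
  have hprod : ∏ i ∈ s.erase 0, p (t i) = ∏ i ∈ s', p (t (i + 1)) := by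
    symm
    refine Finset.prod_bij (fun i _ => i + 1) ?_ ?_ ?_ ?_
    · intro i hi; simpa [hmem] using hi
    · intro a _ b _ h; simpa using h
    · intro b hb
      rw [Finset.mem_erase] at hb
      obtain ⟨m, rfl⟩ := Nat.exists_eq_succ_of_ne_zero hb.1
      exact ⟨m, by simpa [hmem] using hb.2, rfl⟩
    · intros; rfl
  have hpre : ∀ b : ι, (Measure.infinitePi (fun _ : ℕ => p))
      ((fun (ω : ℕ → ι) (k : ℕ) => Nat.casesOn (motive := fun _ => ι) k b ω) ⁻¹'
        ((s : Set ℕ).pi t))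
      = (if 0 ∈ s then Set.indicator (t 0) (fun _ => 1) b else 1) *
        ∏ i ∈ s', p (t (i + 1)) := by
    intro b
    have hset : ((fun (ω : ℕ → ι) (k : ℕ) => Nat.casesOn (motive := fun _ => ι) k b ω) ⁻¹'
        ((s : Set ℕ).pi t)) = {ω | 0 ∈ s → b ∈ t 0} ∩ (s' : Set ℕ).pi (fun i => t (i + 1)) := by
      ext ω
      simp only [Set.mem_preimage, Set.mem_pi, Finset.mem_coe, Set.mem_inter_iff,
        Set.mem_ofPred_eq, hmem]
      constructor
      · intro h
        exact ⟨fun h0 => h 0 h0, fun i hi => h (i + 1) hi⟩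
      · rintro ⟨h0, h1⟩ i hi
        cases i with
        | zero => exact h0 hi
        | succ i => exact h1 i hi
    rw [hset]
    by_cases hc : 0 ∈ s → b ∈ t 0
    · have h1 : {ω : ℕ → ι | 0 ∈ s → b ∈ t 0} = Set.univ := by
        ext; simpa using hc
      rw [h1, Set.univ_inter, Measure.infinitePi_pi _ (fun i _ => ht _)]
      by_cases h0 : 0 ∈ s
      · simp [h0, hc h0]
      · simp [h0]
    · have h1 : {ω : ℕ → ι | 0 ∈ s → b ∈ t 0} = ∅ := by
        ext; simpa using hc
      push Not at hc
      simp [hc.1, hc.2]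
  simp only [Measure.coe_finsetSum, Finset.sum_apply, Measure.smul_apply, smul_eq_mul]
  simp only [Measure.map_apply (hcons _) hmeas, hpre, ← mul_assoc, ← Finset.sum_mul]
  by_cases h0 : 0 ∈ s
  · simp only [h0, if_true]
    rw [← hp _ (ht 0), ← Finset.mul_prod_erase s _ h0, hprod]
  · have h1 := hp Set.univ MeasurableSet.univ
    simp only [measure_univ, Set.indicator_univ] at h1
    simp only [h0, if_false]
    rw [← h1, one_mul, ← hprod, Finset.erase_eq_of_notMem h0]

/-- Existence: the law of `∑_{k ≥ 1} R^{-k} b_k`, with `b_k` independent and uniform in `B`. -/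
theorem exists_isSelfAffineMeasure {d : ℕ} {R : Matrix (Fin d) (Fin d) ℤ} (hR : IsExpansive R)
    {B : Finset (Fin d → ℤ)} (hB : B.Nonempty) :
    ∃ μ : Measure (EuclideanSpace ℝ (Fin d)), IsSelfAffineMeasure R B μ := by
  classical
  have : Nonempty B := hB.to_subtype
  set p : Measure B := (PMF.uniformOfFintype B).toMeasure with hpdef
  set P : Measure (ℕ → B) := Measure.infinitePi (fun _ : ℕ => p) with hP
  set c : ℝ≥0∞ := (B.card : ℝ≥0∞)⁻¹ with hc
  have hp : ∀ t : Set B, MeasurableSet t → p t = ∑ b : B, c * Set.indicator t (fun _ => 1) b := by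
    intro t ht
    rw [hpdef, PMF.toMeasure_apply_fintype]
    refine Finset.sum_congr rfl (fun b _ => ?_)
    by_cases hb : b ∈ t <;> simp [hb, hc]
  have hcons : ∀ b : B, Measurable (fun (ω : ℕ → B) (k : ℕ) =>
      Nat.casesOn (motive := fun _ => B) k b ω) := by
    intro b
    refine measurable_pi_lambda _ (fun k => ?_)
    cases k with
    | zero => exact measurable_const
    | succ k => exact measurable_pi_apply k
  have hinv := infinitePi_eq_sum_cons p c hp hcons
  rw [← hP] at hinv
  set S := invMap R with hS
  have hsum := hR.summable_norm_invMap_pow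
  have hsumω : ∀ ω : ℕ → B, Summable (fun k => (S ^ (k + 1)) (toVec (ω k : Fin d → ℤ))) := by
    intro ω
    refine Summable.of_norm_bounded
      (g := fun k => ‖S ^ (k + 1)‖ * ∑ b : B, ‖toVec (b : Fin d → ℤ)‖)
      (((summable_nat_add_iff 1).2 hsum).mul_right _) (fun k => ?_)
    refine (ContinuousLinearMap.le_opNorm _ _).trans ?_
    gcongr
    exact Finset.single_le_sum (f := fun b : B => ‖toVec (b : Fin d → ℤ)‖)
      (fun _ _ => norm_nonneg _) (Finset.mem_univ (ω k))
  set T : (ℕ → B) → EuclideanSpace ℝ (Fin d) :=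
    fun ω => ∑' k, (S ^ (k + 1)) (toVec (ω k : Fin d → ℤ)) with hT
  have hTmeas : Measurable T := by
    refine measurable_of_tendsto_metrizable
      (f := fun n ω => ∑ k ∈ Finset.range n, (S ^ (k + 1)) (toVec (ω k : Fin d → ℤ)))
      (fun n => ?_) ?_
    · refine Finset.measurable_sum _ (fun k _ => ?_)
      have h1 : Measurable (fun b : B => (S ^ (k + 1)) (toVec (b : Fin d → ℤ))) :=
        measurable_of_countable _
      exact h1.comp (measurable_pi_apply k)
    · rw [tendsto_pi_nhds]
      exact fun ω => (hsumω ω).hasSum.tendsto_sum_nat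
  have hTcons : ∀ (b : B) (ω : ℕ → B),
      T (fun k => Nat.casesOn (motive := fun _ => B) k b ω) = ifsMap R b (T ω) := by
    intro b ω
    rw [hT]
    simp only
    rw [(hsumω (fun k => Nat.casesOn (motive := fun _ => B) k b ω)).tsum_eq_zero_add]
    simp only [ifsMap, ← hS, map_add, zero_add, pow_one]
    rw [ContinuousLinearMap.map_tsum S (hsumω ω), add_comm]
    congr 1
    refine tsum_congr (fun k => ?_)
    rw [pow_succ' S (k + 1)]
    rfl
  have hifs : ∀ b, Measurable (ifsMap R b) := by
    intro b
    unfold ifsMap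
    exact (invMap R).continuous.measurable.comp (measurable_id.add_const _)
  refine ⟨P.map T, ⟨Measure.isProbabilityMeasure_map hTmeas.aemeasurable, fun E hE => ?_⟩⟩
  conv_lhs => rw [Measure.map_apply hTmeas hE, ← hinv]
  simp only [Measure.coe_finsetSum, Finset.sum_apply, Measure.smul_apply, smul_eq_mul]
  rw [← Finset.sum_coe_sort B]
  refine Finset.sum_congr rfl (fun b _ => ?_)
  rw [Measure.map_apply (hcons b) (hTmeas hE), Measure.map_apply hTmeas (hifs b hE)]
  congr 2
  ext ω
  simp only [Set.mem_preimage, hTcons]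

/-- Uniqueness of the self-affine measure. -/
theorem IsSelfAffineMeasure.unique {d : ℕ} {R : Matrix (Fin d) (Fin d) ℤ} (hR : IsExpansive R)
    {B : Finset (Fin d → ℤ)} (hB : B.Nonempty) {μ ν : Measure (EuclideanSpace ℝ (Fin d))}
    (hμ : IsSelfAffineMeasure R B μ) (hν : IsSelfAffineMeasure R B ν) : μ = ν := by
  have := hμ.isProbabilityMeasure
  have := hν.isProbabilityMeasure
  set S := invMap R with hS
  have hifs : ∀ b, Measurable (ifsMap R b) := by
    intro b
    unfold ifsMap
    exact (invMap R).continuous.measurable.comp (measurable_id.add_const _)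
  have hN : (B.card : ℂ) ≠ 0 := by exact_mod_cast hB.card_pos.ne'
  have key : ∀ ρ : Measure (EuclideanSpace ℝ (Fin d)), IsSelfAffineMeasure R B ρ → ∀ t,
      charFun ρ t = ((B.card : ℂ)⁻¹ * ∑ b ∈ B,
        Complex.exp (inner ℝ (S (toVec b)) t * Complex.I)) *
          charFun ρ (ContinuousLinearMap.adjoint S t) := by
    intro ρ hρ t
    have := hρ.isProbabilityMeasure
    have hρeq : ρ = ∑ b ∈ B, (B.card : ℝ≥0∞)⁻¹ • ρ.map (ifsMap R b) := by
      ext E hE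
      rw [hρ.invariant E hE]
      simp only [Measure.coe_finsetSum, Finset.sum_apply, Measure.smul_apply, smul_eq_mul]
      exact Finset.sum_congr rfl (fun b _ => by rw [Measure.map_apply (hifs b) hE])
    have hint : ∀ m : Measure (EuclideanSpace ℝ (Fin d)), IsFiniteMeasure m →
        Integrable (fun x => Complex.exp (inner ℝ x t * Complex.I)) m := by
      intro m _
      refine Integrable.of_bound (C := 1) (by fun_prop) (ae_of_all _ (fun x => ?_))
      rw [Complex.norm_exp_ofReal_mul_I]
    have hcne : (B.card : ℝ≥0∞)⁻¹ ≠ ∞ := by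
      simp [hB.ne_empty]
    have hfin : ∀ b, IsProbabilityMeasure (ρ.map (ifsMap R b)) := fun b =>
      Measure.isProbabilityMeasure_map (hifs b).aemeasurable
    rw [charFun_apply]
    conv_lhs => rw [hρeq]
    rw [integral_finsetSum_measure
      (fun b _ => ((hint (ρ.map (ifsMap R b)) inferInstance).smul_measure hcne))]
    rw [mul_assoc, Finset.sum_mul, Finset.mul_sum]
    refine Finset.sum_congr rfl (fun b _ => ?_)
    rw [integral_smul_measure, integral_map (hifs b).aemeasurable (by fun_prop), charFun_apply,
      ← integral_const_mul]
    have : ((B.card : ℝ≥0∞)⁻¹).toReal = (B.card : ℝ)⁻¹ := by simp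
    rw [this, Complex.real_smul]
    push_cast
    congr 1
    refine integral_congr_ae (ae_of_all _ (fun x => ?_))
    simp only [ifsMap, ← hS]
    rw [← Complex.exp_add, ContinuousLinearMap.adjoint_inner_right, map_add, inner_add_left]
    push_cast
    ring_nf
  refine Measure.ext_of_charFun (funext fun t => ?_)
  have hstep : ∀ t, ‖charFun μ t - charFun ν t‖ ≤
      ‖charFun μ (ContinuousLinearMap.adjoint S t) - charFun ν (ContinuousLinearMap.adjoint S t)‖ := by
    intro t
    rw [key μ hμ t, key ν hν t, ← mul_sub, norm_mul]
    refine mul_le_of_le_one_left (norm_nonneg _) ?_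
    rw [norm_mul, norm_inv, Complex.norm_natCast]
    have hpos : (0 : ℝ) < B.card := by exact_mod_cast hB.card_pos
    rw [inv_mul_le_iff₀ hpos, mul_one]
    refine (norm_sum_le _ _).trans ?_
    simp [Complex.norm_exp_ofReal_mul_I]
  have hiter : ∀ n : ℕ, ‖charFun μ t - charFun ν t‖ ≤
      ‖charFun μ (((ContinuousLinearMap.adjoint S) ^ n) t)
        - charFun ν (((ContinuousLinearMap.adjoint S) ^ n) t)‖ := by
    intro n
    induction n with
    | zero => simp
    | succ n ih =>
      refine ih.trans ((hstep _).trans (le_of_eq ?_))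
      rw [pow_succ']
      rfl
  have hto : Tendsto (fun n : ℕ => ((ContinuousLinearMap.adjoint S) ^ n) t) atTop (𝓝 0) := by
    have h0 : Tendsto (fun n : ℕ => ‖S ^ n‖ * ‖t‖) atTop (𝓝 0) := by
      simpa using hR.summable_norm_invMap_pow.tendsto_atTop_zero.mul_const ‖t‖
    refine squeeze_zero_norm (fun n => ?_) h0
    have h1 : (ContinuousLinearMap.adjoint S) ^ n = star (S ^ n) := by
      rw [star_pow]; rfl
    refine (ContinuousLinearMap.le_opNorm _ _).trans (le_of_eq ?_)
    rw [h1, ContinuousLinearMap.star_eq_adjoint, LinearIsometryEquiv.norm_map]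
  have hlim : Tendsto (fun n : ℕ => ‖charFun μ (((ContinuousLinearMap.adjoint S) ^ n) t)
        - charFun ν (((ContinuousLinearMap.adjoint S) ^ n) t)‖) atTop (𝓝 0) := by
    have h1 : Continuous (fun t => ‖charFun μ t - charFun ν t‖) :=
      (continuous_charFun.sub continuous_charFun).norm
    have h2 := (h1.tendsto 0).comp hto
    simp only [charFun_zero, measureReal_def, measure_univ, sub_self, norm_zero] at h2
    exact h2
  have := ge_of_tendsto' hlim hiter
  exact sub_eq_zero.1 (norm_le_zero_iff.1 this)

end Existence

theorem existsUnique_isSelfAffineMeasure {d : ℕ} {R : Matrix (Fin d) (Fin d) ℤ}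
    (hR : IsExpansive R) {B : Finset (Fin d → ℤ)} (hB : B.Nonempty) :
    ∃! μ : Measure (EuclideanSpace ℝ (Fin d)), IsSelfAffineMeasure R B μ := by
  obtain ⟨μ, hμ⟩ := exists_isSelfAffineMeasure hR hB
  exact ⟨μ, hμ, fun ν hν => hν.unique hR hB hμ⟩

/-- The self-affine measure `μ(R, B)` with equal weights: the unique Borel probability measure
satisfying the invariance identity. -/
noncomputable def selfAffineMeasure {d : ℕ} {R : Matrix (Fin d) (Fin d) ℤ}
    (hR : IsExpansive R) {B : Finset (Fin d → ℤ)} (hB : B.Nonempty) :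
    Measure (EuclideanSpace ℝ (Fin d)) :=
  (existsUnique_isSelfAffineMeasure hR hB).choose

theorem isSelfAffineMeasure_selfAffineMeasure {d : ℕ} {R : Matrix (Fin d) (Fin d) ℤ}
    (hR : IsExpansive R) {B : Finset (Fin d → ℤ)} (hB : B.Nonempty) :
    IsSelfAffineMeasure R B (selfAffineMeasure hR hB) :=
  (existsUnique_isSelfAffineMeasure hR hB).choose_spec.1

instance instIsProbabilityMeasureSelfAffineMeasure {d : ℕ} {R : Matrix (Fin d) (Fin d) ℤ}
    (hR : IsExpansive R) {B : Finset (Fin d → ℤ)} (hB : B.Nonempty) :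
    IsProbabilityMeasure (selfAffineMeasure hR hB) :=
  (isSelfAffineMeasure_selfAffineMeasure hR hB).isProbabilityMeasure

/-! ### Exponentials, frames and spectra -/

/-- The exponential `e_ξ(x) = exp(2 π i ⟨ξ, x⟩)`. -/
noncomputable def expFun {d : ℕ} (ξ x : EuclideanSpace ℝ (Fin d)) : ℂ :=
  Complex.exp (2 * Real.pi * Complex.I * (inner ℝ ξ x : ℝ))

/-- The Fourier coefficient `∫ f(x) exp(-2 π i ⟨ξ, x⟩) dμ(x)`. -/
noncomputable def fourierCoefficient {d : ℕ} (μ : Measure (EuclideanSpace ℝ (Fin d)))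
    (f : EuclideanSpace ℝ (Fin d) → ℂ) (ξ : EuclideanSpace ℝ (Fin d)) : ℂ :=
  ∫ x, f x * Complex.exp (-(2 * Real.pi * Complex.I * (inner ℝ ξ x : ℝ))) ∂μ

/-- The Fourier transform `μ̂(ξ) = ∫ exp(-2 π i ⟨ξ, x⟩) dμ(x)`. -/
noncomputable def measureFourier {d : ℕ} (μ : Measure (EuclideanSpace ℝ (Fin d)))
    (ξ : EuclideanSpace ℝ (Fin d)) : ℂ :=
  ∫ x, Complex.exp (-(2 * Real.pi * Complex.I * (inner ℝ ξ x : ℝ))) ∂μ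

/-- `E(Λ)` is a Fourier frame for `L²(μ)` with lower bound `a` and upper bound `b`. -/
structure IsFourierFrame {d : ℕ} (μ : Measure (EuclideanSpace ℝ (Fin d)))
    (Λ : Set (EuclideanSpace ℝ (Fin d))) (a b : ℝ) : Prop where
  lower_pos : 0 < a
  lower_le_upper : a ≤ b
  summable : ∀ f : Lp ℂ 2 μ, Summable (fun l : Λ => ‖fourierCoefficient μ f l‖ ^ 2)
  lower : ∀ f : Lp ℂ 2 μ, a * ‖f‖ ^ 2 ≤ ∑' l : Λ, ‖fourierCoefficient μ f l‖ ^ 2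
  upper : ∀ f : Lp ℂ 2 μ, ∑' l : Λ, ‖fourierCoefficient μ f l‖ ^ 2 ≤ b * ‖f‖ ^ 2

/-- `E(Λ)` is a Parseval frame (tight, with bound `1`) for `L²(μ)`. -/
def IsParsevalFourierFrame {d : ℕ} (μ : Measure (EuclideanSpace ℝ (Fin d)))
    (Λ : Set (EuclideanSpace ℝ (Fin d))) : Prop :=
  ∀ f : Lp ℂ 2 μ, HasSum (fun l : Λ => ‖fourierCoefficient μ f l‖ ^ 2) (‖f‖ ^ 2)

theorem memLp_expFun {d : ℕ} (μ : Measure (EuclideanSpace ℝ (Fin d))) [IsFiniteMeasure μ]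
    (ξ : EuclideanSpace ℝ (Fin d)) : MemLp (expFun ξ) 2 μ := by
  refine MemLp.of_bound (C := 1) ?_ (ae_of_all _ (fun x => ?_))
  · have : Continuous (expFun ξ) := by unfold expFun; fun_prop
    exact this.aestronglyMeasurable
  · have : expFun ξ x = Complex.exp ((2 * Real.pi * inner ℝ ξ x : ℝ) * Complex.I) := by
      unfold expFun; push_cast; ring_nf
    rw [this, Complex.norm_exp_ofReal_mul_I]

/-- `Λ` is a spectrum for `μ`: the exponentials `e_λ`, `λ ∈ Λ`, form an orthonormal basis
of `L²(μ)`. -/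
def IsSpectrum {d : ℕ} (μ : Measure (EuclideanSpace ℝ (Fin d))) [IsFiniteMeasure μ]
    (Λ : Set (EuclideanSpace ℝ (Fin d))) : Prop :=
  ∃ b : HilbertBasis Λ ℂ (Lp ℂ 2 μ), ∀ l : Λ,
    b l = (memLp_expFun μ (l : EuclideanSpace ℝ (Fin d))).toLp
      (expFun (l : EuclideanSpace ℝ (Fin d)))

/-! ### The sets `J_{n_k}`, `Λ_k`, `Λ` and the quantity `δ(Λ)` -/

/-- The almost-Parseval inequalities for `(R, B)` at level `n`, with frequency set `J` and
error `ε`. Here `N = #B`. -/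
def IsAlmostParseval {d : ℕ} (R : Matrix (Fin d) (Fin d) ℤ) (B : Finset (Fin d → ℤ)) (n : ℕ)
    (J : Finset (Fin d → ℤ)) (ε : ℝ) : Prop :=
  ∀ w : (Fin d → ℤ) → ℂ,
    (1 - ε) * ∑ b ∈ digitSet R B n, ‖w b‖ ^ 2 ≤
      ∑ l ∈ J, ‖((1 / Real.sqrt ((B.card : ℝ) ^ n) : ℝ) : ℂ) * ∑ b ∈ digitSet R B n,
        w b * Complex.exp (-(2 * Real.pi * Complex.I *
          (inner ℝ ((invMap R ^ n) (toVec b)) (toVec l) : ℝ)))‖ ^ 2 ∧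
    ∑ l ∈ J, ‖((1 / Real.sqrt ((B.card : ℝ) ^ n) : ℝ) : ℂ) * ∑ b ∈ digitSet R B n,
        w b * Complex.exp (-(2 * Real.pi * Complex.I *
          (inner ℝ ((invMap R ^ n) (toVec b)) (toVec l) : ℝ)))‖ ^ 2 ≤
      (1 + ε) * ∑ b ∈ digitSet R B n, ‖w b‖ ^ 2

/-- `m_k = n_1 + ⋯ + n_k`; the sequence `n_1, n_2, …` is indexed from `0`, as
`n 0, n 1, …`. -/
def partialLevel (n : ℕ → ℕ) (k : ℕ) : ℕ := ∑ i ∈ Finset.range k, n i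

/-- `Λ_k = J_{n_1} + (Rᵀ)^{m_1} J_{n_2} + ⋯ + (Rᵀ)^{m_{k-1}} J_{n_k}`, with `J i` standing for
`J_{n_{i+1}}`. -/
def freqSet {d : ℕ} (R : Matrix (Fin d) (Fin d) ℤ) (n : ℕ → ℕ) (J : ℕ → Finset (Fin d → ℤ))
    (k : ℕ) : Finset (Fin d → ℤ) :=
  ∑ i ∈ Finset.range k, (J i).image (fun l => (R.transpose ^ partialLevel n i).mulVec l)

/-- `Λ = ⋃_{k ≥ 1} Λ_k`, as a subset of Euclidean space. -/
def freqUnion {d : ℕ} (R : Matrix (Fin d) (Fin d) ℤ) (n : ℕ → ℕ)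
    (J : ℕ → Finset (Fin d → ℤ)) : Set (EuclideanSpace ℝ (Fin d)) :=
  ⋃ k : ℕ, toVec '' (freqSet R n J (k + 1) : Set (Fin d → ℤ))

/-- `δ(Λ) = inf_{k ≥ 1} inf_{λ ∈ Λ_k} |μ̂((Rᵀ)^{-m_k} λ)|²`. -/
noncomputable def deltaInf {d : ℕ} (μ : Measure (EuclideanSpace ℝ (Fin d)))
    (R : Matrix (Fin d) (Fin d) ℤ) (n : ℕ → ℕ) (J : ℕ → Finset (Fin d → ℤ)) : ℝ :=
  ⨅ k : ℕ, ⨅ l : {l : Fin d → ℤ // l ∈ freqSet R n J (k + 1)},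
    ‖measureFourier μ ((invTransposeMap R ^ partialLevel n (k + 1)) (toVec l.1))‖ ^ 2

/-! ### Digit sets and residues -/

/-! The proof transfers finite-dimensional frame inequalities on the digit sets `digitSet R B m` to
`L²(μ)` by Riemann sums.

Discrete side: frame bounds multiply when levels are concatenated (`HasSamplingBounds.add`). In the
combined exponential the cross term between the new frequencies and the rescaled old digits has
integer phase, so the large system is a tensor product of two small ones up to unimodular twists.
This needs every frequency of the combined set to be represented only once. That is automatic: two
congruent frequencies in `J` give equal exponentials and would force an upper bound of at least `2`,
whereas `1 + ε < 2`. Induction yields the partial products as bounds for `Λ_k` at level `m_k`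
(`freqSet_hasSamplingBounds`).

Continuous side: iterating the invariance writes `μ` as an average of copies of itself on cells
attached to the digits of level `m`. The support is bounded and `R⁻ᵐ → 0`, so the cells shrink, and
for continuous compactly supported `f` the sums `discreteCoefficient` converge to the Fourier
coefficients. For a fixed finite family of frequencies the upper bound passes to the limit, which
gives the Bessel inequality.

The lower bound is the harder half, since convergence at each frequency does not prevent mass from
escaping to the new frequencies of `Λ_k`. On cells the exponentials factor, so the discrete
coefficient times `μ̂((Rᵀ)⁻ᵐ l)` is the exact coefficient of a cellwise constant version of `f`. By
Bessel duality these corrected coefficients are close to the true ones in `ℓ²`, uniformly over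
finite subsets of `Λ` (`IsSelfAffineMeasure.eventually_sum_norm_sub_sq_le`). As `|μ̂|² ≥ δ` at the
relevant points, the discrete mass outside a large fixed finite set is at most `δ⁻¹` times something
small. Thus `δ` affects only a vanishing error and not the final constant
(`IsSelfAffineMeasure.lower_bound_of_hasSamplingBounds`). Density extends both bounds to `L²(μ)`. -/

/-- The residue modulo `A` determines the digit, and injectivity of `A` then determines the rest. -/
theorem IsSimpleDigitSet.decompose_unique {d : ℕ} {A : Matrix (Fin d) (Fin d) ℤ}
    {X : Finset (Fin d → ℤ)} (hX : IsSimpleDigitSet A X) (hA : A.det ≠ 0)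
    {x x' y y' : Fin d → ℤ} (hx : x ∈ X) (hx' : x' ∈ X)
    (h : x + A.mulVec y = x' + A.mulVec y') : x = x' ∧ y = y' := by
  have h1 : x = x' := hX x hx x' hx' ⟨y' - y, by
    rw [Matrix.mulVec_sub, sub_eq_sub_iff_add_eq_add, h, add_comm]⟩
  subst h1
  refine ⟨rfl, sub_eq_zero.1 (Matrix.eq_zero_of_mulVec_eq_zero hA ?_)⟩
  rw [Matrix.mulVec_sub, sub_eq_zero]
  exact add_left_cancel h

theorem IsSimpleDigitSet.add_image {d : ℕ} {A A' : Matrix (Fin d) (Fin d) ℤ}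
    {X Y : Finset (Fin d → ℤ)} (hX : IsSimpleDigitSet A X) (hY : IsSimpleDigitSet A' Y)
    (hA : A.det ≠ 0) : IsSimpleDigitSet (A * A') (X + Y.image A.mulVec) := by
  intro b hb b' hb' hk
  obtain ⟨x, hx, _, hy, rfl⟩ := Finset.mem_add.1 hb
  obtain ⟨y, hyY, rfl⟩ := Finset.mem_image.1 hy
  obtain ⟨x', hx', _, hy', rfl⟩ := Finset.mem_add.1 hb'
  obtain ⟨y', hyY', rfl⟩ := Finset.mem_image.1 hy'
  obtain ⟨k, hk⟩ := hk
  have h1 : x + A.mulVec y = x' + A.mulVec (y' + A'.mulVec k) := by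
    rw [Matrix.mulVec_add, Matrix.mulVec_mulVec, ← add_assoc, ← hk]
    abel
  obtain ⟨rfl, h2⟩ := hX.decompose_unique hA hx hx' h1
  have h3 : y = y' := hY y hyY y' hyY' ⟨k, by rw [h2]; abel⟩
  rw [h3]

/-- A Minkowski sum of finsets forgets multiplicity; simplicity makes the addition map injective, so
nothing is lost. Used both for digits (with `R`) and for frequencies (with `Rᵀ`). -/
theorem IsSimpleDigitSet.sum_add_image {d : ℕ} {A : Matrix (Fin d) (Fin d) ℤ}
    {X : Finset (Fin d → ℤ)} (hX : IsSimpleDigitSet A X) (hA : A.det ≠ 0)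
    (Y : Finset (Fin d → ℤ)) {M : Type*} [AddCommMonoid M] (φ : (Fin d → ℤ) → M) :
    ∑ z ∈ X + Y.image A.mulVec, φ z = ∑ x ∈ X, ∑ y ∈ Y, φ (x + A.mulVec y) := by
  rw [← Finset.sum_product', eq_comm]
  refine Finset.sum_bij (fun p _ => p.1 + A.mulVec p.2) ?_ ?_ ?_ (fun _ _ => rfl)
  · rintro ⟨x, y⟩ h
    rw [Finset.mem_product] at h
    exact Finset.add_mem_add h.1 (Finset.mem_image_of_mem _ h.2)
  · rintro ⟨x, y⟩ h ⟨x', y'⟩ h' heq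
    rw [Finset.mem_product] at h h'
    obtain ⟨h1, h2⟩ := hX.decompose_unique hA h.1 h'.1 heq
    rw [Prod.mk.injEq]
    exact ⟨h1, h2⟩
  · intro z hz
    obtain ⟨x, hx, _, hy, rfl⟩ := Finset.mem_add.1 hz
    obtain ⟨y, hyY, rfl⟩ := Finset.mem_image.1 hy
    exact ⟨(x, y), Finset.mem_product.2 ⟨hx, hyY⟩, rfl⟩

/-- Here `0` is the pointwise zero `{0}`, the value of an empty Minkowski sum, and not the empty
set; it starts the inductions at level zero. -/
theorem isSimpleDigitSet_zero {d : ℕ} (A : Matrix (Fin d) (Fin d) ℤ) :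
    IsSimpleDigitSet A 0 := by
  intro b hb b' hb' _
  rw [Finset.mem_zero] at hb hb'
  rw [hb, hb']

theorem det_pow_ne_zero {d : ℕ} {R : Matrix (Fin d) (Fin d) ℤ} (hR : R.det ≠ 0) (m : ℕ) :
    (R ^ m).det ≠ 0 := by
  rw [Matrix.det_pow]; exact pow_ne_zero _ hR

theorem digitSet_zero {d : ℕ} (R : Matrix (Fin d) (Fin d) ℤ) (B : Finset (Fin d → ℤ)) :
    digitSet R B 0 = 0 := rfl

theorem digitSet_succ {d : ℕ} (R : Matrix (Fin d) (Fin d) ℤ) (B : Finset (Fin d → ℤ)) (m : ℕ) :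
    digitSet R B (m + 1) = digitSet R B m + B.image (R ^ m).mulVec :=
  Finset.sum_range_succ _ _

theorem digitSet_add {d : ℕ} (R : Matrix (Fin d) (Fin d) ℤ) (B : Finset (Fin d → ℤ)) (m n : ℕ) :
    digitSet R B (m + n) = digitSet R B m + (digitSet R B n).image (R ^ m).mulVec := by
  induction n with
  | zero =>
    rw [digitSet_zero, add_zero, ← Finset.singleton_zero, Finset.image_singleton,
      Matrix.mulVec_zero, Finset.singleton_zero, add_zero]
  | succ n ih =>
    have h := Finset.image_add (Matrix.mulVecLin (R ^ m)) (s := digitSet R B n)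
      (t := B.image (R ^ n).mulVec)
    simp only [Matrix.coe_mulVecLin] at h
    rw [← add_assoc, digitSet_succ, ih, digitSet_succ, h, Finset.image_image, add_assoc]
    congr 2
    refine Finset.image_congr (fun b _ => ?_)
    simp only [Function.comp_apply, Matrix.mulVec_mulVec, pow_add]

theorem IsSimpleDigitSet.digitSet {d : ℕ} {R : Matrix (Fin d) (Fin d) ℤ}
    {B : Finset (Fin d → ℤ)} (hB : IsSimpleDigitSet R B) (hR : R.det ≠ 0) (m : ℕ) :
    IsSimpleDigitSet (R ^ m) (digitSet R B m) := by
  induction m with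
  | zero => exact isSimpleDigitSet_zero _
  | succ m ih =>
    rw [digitSet_succ, pow_succ]
    exact ih.add_image hB (det_pow_ne_zero hR m)

theorem IsSimpleDigitSet.card_digitSet {d : ℕ} {R : Matrix (Fin d) (Fin d) ℤ}
    {B : Finset (Fin d → ℤ)} (hB : IsSimpleDigitSet R B) (hR : R.det ≠ 0) (m : ℕ) :
    (_root_.digitSet R B m).card = B.card ^ m := by
  induction m with
  | zero => simp [digitSet_zero]
  | succ m ih =>
    rw [digitSet_succ, Finset.card_eq_sum_ones,
      (hB.digitSet hR m).sum_add_image (det_pow_ne_zero hR m)]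
    simp [ih, pow_succ]

/-! ### Integer vectors, the inverse map and exponentials -/

theorem toVec_add {d : ℕ} (a b : Fin d → ℤ) : toVec (a + b) = toVec a + toVec b := by
  ext i; simp [toVec]

theorem toVec_zero {d : ℕ} : toVec (0 : Fin d → ℤ) = 0 := by
  ext i; simp [toVec]

theorem toVec_injective {d : ℕ} : Function.Injective (toVec (d := d)) := by
  intro a b h
  funext i
  have := congrArg (fun v : EuclideanSpace ℝ (Fin d) => v i) h
  simpa [toVec] using this

theorem inner_toVec_toVec {d : ℕ} (a b : Fin d → ℤ) :
    inner ℝ (toVec a) (toVec b) = ((∑ i, b i * a i : ℤ) : ℝ) := by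
  simp [toVec, PiLp.inner_apply]

theorem isUnit_det_realMat {d : ℕ} {R : Matrix (Fin d) (Fin d) ℤ} (hR : R.det ≠ 0) :
    IsUnit (realMat R).det := by
  have h : (realMat R).det = ((R.det : ℤ) : ℝ) := ((Int.castRingHom ℝ).map_det R).symm
  rw [h, isUnit_iff_ne_zero]
  exact_mod_cast hR

theorem toVec_mulVec {d : ℕ} (R : Matrix (Fin d) (Fin d) ℤ) (b : Fin d → ℤ) :
    toVec (R.mulVec b) = Matrix.toEuclideanCLM (𝕜 := ℝ) (realMat R) (toVec b) := by
  rw [toVec, toVec, Matrix.toEuclideanCLM_toLp]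
  congr 1
  funext i
  simp [Matrix.mulVec, dotProduct, realMat]

theorem invMap_toVec_mulVec {d : ℕ} {R : Matrix (Fin d) (Fin d) ℤ} (hR : R.det ≠ 0)
    (b : Fin d → ℤ) : invMap R (toVec (R.mulVec b)) = toVec b := by
  rw [toVec_mulVec, invMap, ← mul_apply_eq_comp, ← map_mul,
    Matrix.nonsing_inv_mul _ (isUnit_det_realMat hR), map_one]
  rfl

theorem invMap_pow_toVec_mulVec {d : ℕ} {R : Matrix (Fin d) (Fin d) ℤ} (hR : R.det ≠ 0)
    (m : ℕ) (b : Fin d → ℤ) : (invMap R ^ m) (toVec ((R ^ m).mulVec b)) = toVec b := by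
  induction m with
  | zero => simp
  | succ m ih =>
    rw [pow_succ, pow_succ', mul_apply_eq_comp, ← Matrix.mulVec_mulVec,
      invMap_toVec_mulVec hR, ih]

theorem inner_toVec_transpose {d : ℕ} {R : Matrix (Fin d) (Fin d) ℤ} (hR : R.det ≠ 0)
    (l : Fin d → ℤ) (x : EuclideanSpace ℝ (Fin d)) :
    inner ℝ (toVec (R.transpose.mulVec l)) (invMap R x) = inner ℝ (toVec l) x := by
  have h1 : star (Matrix.toEuclideanCLM (𝕜 := ℝ) (realMat R)) =
      Matrix.toEuclideanCLM (𝕜 := ℝ) (realMat R.transpose) := by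
    rw [← map_star]
    congr 1
  rw [toVec_mulVec, ← h1, ContinuousLinearMap.star_eq_adjoint,
    ContinuousLinearMap.adjoint_inner_left, invMap, ← mul_apply_eq_comp, ← map_mul,
    Matrix.mul_nonsing_inv _ (isUnit_det_realMat hR), map_one]
  rfl

theorem inner_toVec_transpose_pow {d : ℕ} {R : Matrix (Fin d) (Fin d) ℤ} (hR : R.det ≠ 0)
    (m : ℕ) (l : Fin d → ℤ) (x : EuclideanSpace ℝ (Fin d)) :
    inner ℝ (toVec ((R.transpose ^ m).mulVec l)) ((invMap R ^ m) x) = inner ℝ (toVec l) x := by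
  induction m generalizing x with
  | zero => simp
  | succ m ih =>
    rw [pow_succ', pow_succ', mul_apply_eq_comp, ← Matrix.mulVec_mulVec,
      inner_toVec_transpose hR, ih]

theorem inner_invTransposeMap {d : ℕ} (R : Matrix (Fin d) (Fin d) ℤ)
    (x y : EuclideanSpace ℝ (Fin d)) :
    inner ℝ (invTransposeMap R x) y = inner ℝ x (invMap R y) := by
  have h1 : star (invMap R) = invTransposeMap R := by
    rw [invMap, invTransposeMap, ← map_star, ← Matrix.transpose_nonsing_inv]
    congr 1
  rw [← h1, ContinuousLinearMap.star_eq_adjoint, ContinuousLinearMap.adjoint_inner_left]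

theorem inner_invTransposeMap_pow {d : ℕ} (R : Matrix (Fin d) (Fin d) ℤ) (m : ℕ)
    (x y : EuclideanSpace ℝ (Fin d)) :
    inner ℝ ((invTransposeMap R ^ m) x) y = inner ℝ x ((invMap R ^ m) y) := by
  induction m generalizing x with
  | zero => simp
  | succ m ih =>
    rw [pow_succ, pow_succ', mul_apply_eq_comp, ih, inner_invTransposeMap]
    rfl

/-- The conjugate exponential `exp(-2 π i ⟨ξ, x⟩)`. -/
noncomputable def negExp {d : ℕ} (ξ x : EuclideanSpace ℝ (Fin d)) : ℂ :=
  Complex.exp (-(2 * Real.pi * Complex.I * (inner ℝ ξ x : ℝ)))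

theorem norm_negExp {d : ℕ} (ξ x : EuclideanSpace ℝ (Fin d)) : ‖negExp ξ x‖ = 1 := by
  have : negExp ξ x = Complex.exp ((-(2 * Real.pi * inner ℝ ξ x) : ℝ) * Complex.I) := by
    unfold negExp; push_cast; ring_nf
  rw [this, Complex.norm_exp_ofReal_mul_I]

theorem negExp_add_left {d : ℕ} (ξ ξ' x : EuclideanSpace ℝ (Fin d)) :
    negExp (ξ + ξ') x = negExp ξ x * negExp ξ' x := by
  unfold negExp; rw [← Complex.exp_add, inner_add_left]; push_cast; ring_nf

theorem negExp_add_right {d : ℕ} (ξ x x' : EuclideanSpace ℝ (Fin d)) :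
    negExp ξ (x + x') = negExp ξ x * negExp ξ x' := by
  unfold negExp; rw [← Complex.exp_add, inner_add_right]; push_cast; ring_nf

theorem negExp_toVec_toVec {d : ℕ} (a b : Fin d → ℤ) : negExp (toVec a) (toVec b) = 1 := by
  unfold negExp
  rw [inner_toVec_toVec, Complex.exp_eq_one_iff]
  exact ⟨-∑ i, b i * a i, by push_cast; ring⟩

theorem continuous_negExp {d : ℕ} (ξ : EuclideanSpace ℝ (Fin d)) : Continuous (negExp ξ) := by
  unfold negExp; fun_prop

theorem conj_expFun {d : ℕ} (ξ x : EuclideanSpace ℝ (Fin d)) :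
    (starRingEnd ℂ) (expFun ξ x) = negExp ξ x := by
  unfold expFun negExp
  rw [← Complex.exp_conj]
  congr 1
  simp only [map_mul, Complex.conj_ofReal, Complex.conj_I, map_ofNat]
  ring

theorem negExp_transpose_pow {d : ℕ} {R : Matrix (Fin d) (Fin d) ℤ} (hR : R.det ≠ 0)
    (m n : ℕ) (l : Fin d → ℤ) (x : EuclideanSpace ℝ (Fin d)) :
    negExp (toVec ((R.transpose ^ m).mulVec l)) ((invMap R ^ (m + n)) x) =
      negExp (toVec l) ((invMap R ^ n) x) := by
  unfold negExp
  rw [pow_add, mul_apply_eq_comp, inner_toVec_transpose_pow hR]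

/-! ### Sampling bounds for finite exponential systems -/

/-- The exponentials with frequencies in `J` satisfy the frame inequalities with bounds `a`, `b`
on functions on the `n`-th level digit set, with normalization `N^{-n/2}`. -/
def HasSamplingBounds {d : ℕ} (R : Matrix (Fin d) (Fin d) ℤ) (B : Finset (Fin d → ℤ)) (n : ℕ)
    (J : Finset (Fin d → ℤ)) (a b : ℝ) : Prop :=
  ∀ w : (Fin d → ℤ) → ℂ,
    a * ∑ b ∈ digitSet R B n, ‖w b‖ ^ 2 ≤
      ∑ l ∈ J, ‖((1 / Real.sqrt ((B.card : ℝ) ^ n) : ℝ) : ℂ) * ∑ b ∈ digitSet R B n,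
        w b * negExp (toVec l) ((invMap R ^ n) (toVec b))‖ ^ 2 ∧
    ∑ l ∈ J, ‖((1 / Real.sqrt ((B.card : ℝ) ^ n) : ℝ) : ℂ) * ∑ b ∈ digitSet R B n,
        w b * negExp (toVec l) ((invMap R ^ n) (toVec b))‖ ^ 2 ≤
      b * ∑ b ∈ digitSet R B n, ‖w b‖ ^ 2

theorem IsAlmostParseval.hasSamplingBounds {d : ℕ} {R : Matrix (Fin d) (Fin d) ℤ}
    {B : Finset (Fin d → ℤ)} {n : ℕ} {J : Finset (Fin d → ℤ)} {ε : ℝ}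
    (h : IsAlmostParseval R B n J ε) : HasSamplingBounds R B n J (1 - ε) (1 + ε) := by
  intro w
  have := h w
  simp only [negExp]
  simpa only [real_inner_comm] using this

/-- Congruent frequencies restrict to the same function on the sampling points. Testing the upper
inequality on that function counts its energy twice, which a constant below `2` does not allow. -/
theorem HasSamplingBounds.isSimpleDigitSet {d : ℕ} {R : Matrix (Fin d) (Fin d) ℤ}
    (hR : R.det ≠ 0) {B : Finset (Fin d → ℤ)} (hB : B.Nonempty) (hs : IsSimpleDigitSet R B)
    {n : ℕ} {J : Finset (Fin d → ℤ)} {a b : ℝ} (h : HasSamplingBounds R B n J a b) (hb : b < 2) :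
    IsSimpleDigitSet (R.transpose ^ n) J := by
  intro l hl l' hl' hk
  obtain ⟨k, hk⟩ := hk
  by_contra hne
  have hN : (0 : ℝ) < (B.card : ℝ) ^ n := pow_pos (by exact_mod_cast hB.card_pos) n
  have hsame : ∀ b : Fin d → ℤ, negExp (toVec l) ((invMap R ^ n) (toVec b)) =
      negExp (toVec l') ((invMap R ^ n) (toVec b)) := by
    intro b
    have h1 : l = l' + (R.transpose ^ n).mulVec k := by rw [← hk]; abel
    -- With second exponent `0`, the phase of `(Rᵀ)ⁿ k` at `R⁻ⁿ b` becomes the integer `⟨k, b⟩`.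
    have h2 := negExp_transpose_pow hR n 0 k (toVec b)
    rw [pow_zero, add_zero, one_apply_eq_self, negExp_toVec_toVec] at h2
    rw [h1, toVec_add, negExp_add_left, h2, mul_one]
  -- The conjugate of the repeated exponential: every summand at `l`, hence also at `l'`, equals
  -- `1`, so each of the two frequencies contributes `Nⁿ`, while the right side is `b * Nⁿ`.
  have h1 := (h (fun b => (starRingEnd ℂ) (negExp (toVec l) ((invMap R ^ n) (toVec b))))).2
  have hval : ‖((1 / Real.sqrt ((B.card : ℝ) ^ n) : ℝ) : ℂ) * ∑ b ∈ digitSet R B n,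
      (starRingEnd ℂ) (negExp (toVec l) ((invMap R ^ n) (toVec b))) *
        negExp (toVec l) ((invMap R ^ n) (toVec b))‖ ^ 2 = (B.card : ℝ) ^ n := by
    simp only [mul_comm ((starRingEnd ℂ) _), Complex.mul_conj', norm_negExp]
    simp only [Complex.ofReal_one, one_pow, Finset.sum_const, hs.card_digitSet hR, nsmul_eq_mul,
      mul_one, norm_mul, Complex.norm_real]
    rw [mul_pow, Real.norm_eq_abs, sq_abs, div_pow, Real.sq_sqrt hN.le]
    simp only [Nat.cast_pow, norm_pow, Complex.norm_natCast]
    field_simp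
  have hsub : ({l, l'} : Finset (Fin d → ℤ)) ⊆ J := by
    intro x hx
    rw [Finset.mem_insert, Finset.mem_singleton] at hx
    rcases hx with rfl | rfl <;> assumption
  have h2 := (Finset.sum_le_sum_of_subset_of_nonneg hsub
    (fun i _ _ => sq_nonneg _)).trans h1
  rw [Finset.sum_pair hne] at h2
  simp only [← hsame] at h2
  rw [hval] at h2
  simp only [RCLike.norm_conj, norm_negExp, one_pow, Finset.sum_const, hs.card_digitSet hR,
    nsmul_eq_mul, mul_one, Nat.cast_pow] at h2
  nlinarith

theorem hasSamplingBounds_zero {d : ℕ} (R : Matrix (Fin d) (Fin d) ℤ)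
    (B : Finset (Fin d → ℤ)) : HasSamplingBounds R B 0 0 1 1 := by
  intro w
  simp [digitSet_zero, ← Finset.singleton_zero, toVec_zero, norm_negExp]

/-- A two-stage transform, as in the fast Fourier transform: first sum over the digits `y` of level
`m` against `l`, then over the digits `x` of level `n` against `j`. The only coupling between the
stages is a factor of modulus one depending on `l` and `x`. -/
theorem HasSamplingBounds.add {d : ℕ} {R : Matrix (Fin d) (Fin d) ℤ}
    (hR : R.det ≠ 0) {B : Finset (Fin d → ℤ)} (hs : IsSimpleDigitSet R B)
    {m n : ℕ} {L J : Finset (Fin d → ℤ)} {a b a' b' : ℝ} (h : HasSamplingBounds R B m L a b)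
    (h' : HasSamplingBounds R B n J a' b') (ha' : 0 ≤ a') (hb' : 0 ≤ b')
    (hL : IsSimpleDigitSet (R.transpose ^ m) L) :
    HasSamplingBounds R B (m + n) (L + J.image (R.transpose ^ m).mulVec) (a * a') (b * b') := by
  intro w
  have hdt : (R.transpose ^ m).det ≠ 0 := det_pow_ne_zero (by rwa [Matrix.det_transpose]) m
  have hsum : ∀ {M : Type} [AddCommMonoid M] (φ : (Fin d → ℤ) → M),
      ∑ z ∈ digitSet R B (m + n), φ z =
        ∑ x ∈ digitSet R B n, ∑ y ∈ digitSet R B m, φ (x + (R ^ n).mulVec y) := by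
    intro M _ φ
    -- The digits split in the opposite order to the frequencies: the level-`n` block is unscaled
    -- here, whereas the level-`n` frequencies carry the factor `(Rᵀ)ᵐ`. This is what makes the
    -- cross term integral.
    rw [add_comm m n, digitSet_add]
    exact (hs.digitSet hR n).sum_add_image (det_pow_ne_zero hR n) _ φ
  -- Output of the first stage including the twist; for fixed `l` it is the weight fed into the
  -- second stage.
  set v : (Fin d → ℤ) → (Fin d → ℤ) → ℂ := fun l x =>
    negExp (toVec l) ((invMap R ^ (m + n)) (toVec x)) *
      (((1 / Real.sqrt ((B.card : ℝ) ^ m) : ℝ) : ℂ) * ∑ y ∈ digitSet R B m,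
        w (x + (R ^ n).mulVec y) * negExp (toVec l) ((invMap R ^ m) (toVec y))) with hv
  have hphase : ∀ l j x y : Fin d → ℤ,
      negExp (toVec (l + (R.transpose ^ m).mulVec j))
        ((invMap R ^ (m + n)) (toVec (x + (R ^ n).mulVec y))) =
      negExp (toVec l) ((invMap R ^ (m + n)) (toVec x)) *
        negExp (toVec l) ((invMap R ^ m) (toVec y)) *
        negExp (toVec j) ((invMap R ^ n) (toVec x)) := by
    intro l j x y
    have e1 : (invMap R ^ (m + n)) (toVec ((R ^ n).mulVec y)) = (invMap R ^ m) (toVec y) := by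
      rw [pow_add, mul_apply_eq_comp, invMap_pow_toVec_mulVec hR]
    rw [toVec_add l, negExp_add_left, negExp_transpose_pow hR, toVec_add x, map_add, e1,
      negExp_add_right, map_add, negExp_add_right, invMap_pow_toVec_mulVec hR,
      negExp_toVec_toVec, mul_one]
  have hterm : ∀ l j : Fin d → ℤ,
      ((1 / Real.sqrt ((B.card : ℝ) ^ (m + n)) : ℝ) : ℂ) * ∑ z ∈ digitSet R B (m + n),
        w z * negExp (toVec (l + (R.transpose ^ m).mulVec j)) ((invMap R ^ (m + n)) (toVec z)) =
      ((1 / Real.sqrt ((B.card : ℝ) ^ n) : ℝ) : ℂ) * ∑ x ∈ digitSet R B n,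
        v l x * negExp (toVec j) ((invMap R ^ n) (toVec x)) := by
    intro l j
    have hc : ((1 / Real.sqrt ((B.card : ℝ) ^ (m + n)) : ℝ) : ℂ) =
        ((1 / Real.sqrt ((B.card : ℝ) ^ n) : ℝ) : ℂ) *
          ((1 / Real.sqrt ((B.card : ℝ) ^ m) : ℝ) : ℂ) := by
      rw [pow_add, Real.sqrt_mul (by positivity), ← Complex.ofReal_mul]
      congr 1
      rw [div_mul_div_comm, one_mul, mul_comm (Real.sqrt _)]
    rw [hsum, hc, mul_assoc]
    congr 1
    rw [Finset.mul_sum]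
    refine Finset.sum_congr rfl (fun x _ => ?_)
    rw [hv]
    simp only [hphase, Finset.mul_sum, Finset.sum_mul]
    refine Finset.sum_congr rfl (fun y _ => ?_)
    ring
  have hnorm : ∀ l x : Fin d → ℤ, ‖v l x‖ =
      ‖((1 / Real.sqrt ((B.card : ℝ) ^ m) : ℝ) : ℂ) * ∑ y ∈ digitSet R B m,
        w (x + (R ^ n).mulVec y) * negExp (toVec l) ((invMap R ^ m) (toVec y))‖ := by
    intro l x
    rw [hv]
    simp only
    rw [norm_mul, norm_negExp, one_mul]
  rw [hL.sum_add_image hdt, hsum]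
  simp only [hterm]
  -- The twist drops out of the norms, so after interchanging the sums the level-`m` inequality
  -- applies to each slice with `x` fixed.
  have hswap : ∑ l ∈ L, ∑ x ∈ digitSet R B n, ‖v l x‖ ^ 2 =
      ∑ x ∈ digitSet R B n, ∑ l ∈ L, ‖((1 / Real.sqrt ((B.card : ℝ) ^ m) : ℝ) : ℂ) *
        ∑ y ∈ digitSet R B m,
          w (x + (R ^ n).mulVec y) * negExp (toVec l) ((invMap R ^ m) (toVec y))‖ ^ 2 := by
    simp only [hnorm]
    exact Finset.sum_comm
  constructor
  · calc a * a' * ∑ x ∈ digitSet R B n, ∑ y ∈ digitSet R B m, ‖w (x + (R ^ n).mulVec y)‖ ^ 2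
        = a' * ∑ x ∈ digitSet R B n, a * ∑ y ∈ digitSet R B m, ‖w (x + (R ^ n).mulVec y)‖ ^ 2 := by
          rw [← Finset.mul_sum]; ring
      _ ≤ a' * ∑ l ∈ L, ∑ x ∈ digitSet R B n, ‖v l x‖ ^ 2 := by
          rw [hswap]
          gcongr with x _
          exact (h (fun y => w (x + (R ^ n).mulVec y))).1
      _ ≤ _ := by
          rw [Finset.mul_sum]
          exact Finset.sum_le_sum (fun l _ => (h' (v l)).1)
  · calc _ ≤ b' * ∑ l ∈ L, ∑ x ∈ digitSet R B n, ‖v l x‖ ^ 2 := by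
          rw [Finset.mul_sum]
          exact Finset.sum_le_sum (fun l _ => (h' (v l)).2)
      _ ≤ b' * ∑ x ∈ digitSet R B n, b * ∑ y ∈ digitSet R B m,
            ‖w (x + (R ^ n).mulVec y)‖ ^ 2 := by
          rw [hswap]
          gcongr with x _
          exact (h (fun y => w (x + (R ^ n).mulVec y))).2
      _ = _ := by
          rw [← Finset.mul_sum]; ring

/-! ### The frequency sets -/

theorem freqSet_succ {d : ℕ} (R : Matrix (Fin d) (Fin d) ℤ) (n : ℕ → ℕ)
    (J : ℕ → Finset (Fin d → ℤ)) (k : ℕ) :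
    freqSet R n J (k + 1) =
      freqSet R n J k + (J k).image (R.transpose ^ partialLevel n k).mulVec :=
  Finset.sum_range_succ _ _

theorem partialLevel_succ (n : ℕ → ℕ) (k : ℕ) :
    partialLevel n (k + 1) = partialLevel n k + n k :=
  Finset.sum_range_succ _ _

theorem tendsto_partialLevel {n : ℕ → ℕ} (hn : ∀ k, 0 < n k) :
    Tendsto (partialLevel n) atTop atTop :=
  (strictMono_nat_of_lt_succ (fun k => by
    rw [partialLevel_succ]; exact Nat.lt_add_of_pos_right (hn k))).tendsto_atTop

/-- Nestedness, from `0 ∈ J k`, puts any finite part of `Λ` inside all late `Λ_k`, which is what the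
limit arguments need. -/
theorem freqSet_mono {d : ℕ} (R : Matrix (Fin d) (Fin d) ℤ) (n : ℕ → ℕ)
    {J : ℕ → Finset (Fin d → ℤ)} (hJ0 : ∀ k, 0 ∈ J k) : Monotone (freqSet R n J) := by
  refine monotone_nat_of_le_succ (fun k x hx => ?_)
  rw [freqSet_succ, ← add_zero x]
  exact Finset.add_mem_add hx (Finset.mem_image.2 ⟨0, hJ0 k, Matrix.mulVec_zero _⟩)

/-- Both claims are proved together because composing the bounds requires the simplicity of the
frequencies gathered so far. -/
theorem freqSet_hasSamplingBounds {d : ℕ} {R : Matrix (Fin d) (Fin d) ℤ} (hR : R.det ≠ 0)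
    {B : Finset (Fin d → ℤ)} (hB : B.Nonempty) (hs : IsSimpleDigitSet R B) {ε : ℕ → ℝ}
    (hε0 : ∀ k, 0 ≤ ε k) (hε1 : ∀ k, ε k < 1) {n : ℕ → ℕ} {J : ℕ → Finset (Fin d → ℤ)}
    (hJ : ∀ k, IsAlmostParseval R B (n k) (J k) (ε k)) (k : ℕ) :
    IsSimpleDigitSet (R.transpose ^ partialLevel n k) (freqSet R n J k) ∧
    HasSamplingBounds R B (partialLevel n k) (freqSet R n J k)
      (∏ j ∈ Finset.range k, (1 - ε j)) (∏ j ∈ Finset.range k, (1 + ε j)) := by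
  induction k with
  | zero => exact ⟨isSimpleDigitSet_zero _, hasSamplingBounds_zero R B⟩
  | succ k ih =>
    have hk := (hJ k).hasSamplingBounds
    have hε := hε0 k
    have hε' := hε1 k
    rw [freqSet_succ, partialLevel_succ, Finset.prod_range_succ, Finset.prod_range_succ]
    refine ⟨?_, ih.2.add hR hs hk (by linarith) (by linarith) ih.1⟩
    rw [pow_add]
    exact ih.1.add_image (hk.isSimpleDigitSet hR hB hs (by linarith))
      (det_pow_ne_zero (by rwa [Matrix.det_transpose]) _)

/-! ### Iterating the invariance of the measure -/

theorem integrable_of_continuous_bounded {d : ℕ} {μ : Measure (EuclideanSpace ℝ (Fin d))}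
    [IsFiniteMeasure μ] {F : Type*} [NormedAddCommGroup F] {g : EuclideanSpace ℝ (Fin d) → F}
    (hg : Continuous g) {C : ℝ} (hC : ∀ x, ‖g x‖ ≤ C) : Integrable g μ :=
  Integrable.of_bound hg.aestronglyMeasurable C (ae_of_all _ hC)

theorem IsSelfAffineMeasure.integral_eq {d : ℕ} {R : Matrix (Fin d) (Fin d) ℤ}
    {B : Finset (Fin d → ℤ)} (hB : B.Nonempty) {μ : Measure (EuclideanSpace ℝ (Fin d))}
    (hμ : IsSelfAffineMeasure R B μ) {F : Type*} [NormedAddCommGroup F] [NormedSpace ℝ F]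
    {g : EuclideanSpace ℝ (Fin d) → F} (hg : Continuous g) {C : ℝ} (hC : ∀ x, ‖g x‖ ≤ C) :
    ∫ x, g x ∂μ = (B.card : ℝ)⁻¹ • ∑ b ∈ B, ∫ y, g (invMap R (y + toVec b)) ∂μ := by
  have := hμ.isProbabilityMeasure
  have hifs : ∀ b, Measurable (ifsMap R b) := by
    intro b
    unfold ifsMap
    exact (invMap R).continuous.measurable.comp (measurable_id.add_const _)
  have hμeq : μ = ∑ b ∈ B, (B.card : ℝ≥0∞)⁻¹ • μ.map (ifsMap R b) := by
    ext E hE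
    rw [hμ.invariant E hE]
    simp only [Measure.coe_finsetSum, Finset.sum_apply, Measure.smul_apply, smul_eq_mul]
    exact Finset.sum_congr rfl (fun b _ => by rw [Measure.map_apply (hifs b) hE])
  have hcne : (B.card : ℝ≥0∞)⁻¹ ≠ ∞ := by
    simp [hB.ne_empty]
  have hfin : ∀ b, IsProbabilityMeasure (μ.map (ifsMap R b)) := fun b =>
    Measure.isProbabilityMeasure_map (hifs b).aemeasurable
  conv_lhs => rw [hμeq]
  rw [integral_finsetSum_measure
    (fun b _ => (integrable_of_continuous_bounded hg hC).smul_measure hcne), Finset.smul_sum]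
  refine Finset.sum_congr rfl (fun b _ => ?_)
  rw [integral_smul_measure, integral_map (hifs b).aemeasurable hg.aestronglyMeasurable]
  simp [ifsMap]

theorem IsSelfAffineMeasure.integral_eq_digitSet {d : ℕ} {R : Matrix (Fin d) (Fin d) ℤ}
    (hR : R.det ≠ 0) {B : Finset (Fin d → ℤ)} (hB : B.Nonempty) (hs : IsSimpleDigitSet R B)
    {μ : Measure (EuclideanSpace ℝ (Fin d))}
    (hμ : IsSelfAffineMeasure R B μ) {F : Type*} [NormedAddCommGroup F] [NormedSpace ℝ F]
    (m : ℕ) {g : EuclideanSpace ℝ (Fin d) → F} (hg : Continuous g) {C : ℝ}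
    (hC : ∀ x, ‖g x‖ ≤ C) :
    ∫ x, g x ∂μ =
      ((B.card : ℝ) ^ m)⁻¹ • ∑ b ∈ digitSet R B m, ∫ y, g ((invMap R ^ m) (y + toVec b)) ∂μ := by
  induction m generalizing g with
  | zero => simp [digitSet_zero, ← Finset.singleton_zero, toVec_zero]
  | succ m ih =>
    rw [hμ.integral_eq hB hg hC, digitSet_succ,
      (hs.digitSet hR m).sum_add_image (det_pow_ne_zero hR m), pow_succ', mul_inv, mul_smul,
      Finset.sum_comm, Finset.smul_sum (r := ((B.card : ℝ) ^ m)⁻¹)]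
    congr 1
    refine Finset.sum_congr rfl (fun b _ => ?_)
    -- The outermost map contributes the highest digit: `R⁻¹(R⁻ᵐ(y + x) + b) = R⁻⁽ᵐ⁺¹⁾(y + x + Rᵐ
    -- b)`.
    rw [ih (g := fun y => g (invMap R (y + toVec b))) (by fun_prop) (fun x => hC _)]
    have h1 : (invMap R ^ (m + 1)) (toVec ((R ^ m).mulVec b)) = invMap R (toVec b) := by
      rw [pow_succ', mul_apply_eq_comp, invMap_pow_toVec_mulVec hR]
    simp only [toVec_add, map_add, pow_succ' (invMap R), mul_apply_eq_comp, add_assoc] at h1 ⊢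
    simp only [h1]

theorem IsExpansive.exists_norm_digit_le {d : ℕ} {R : Matrix (Fin d) (Fin d) ℤ}
    (hR : IsExpansive R) (B : Finset (Fin d → ℤ)) :
    ∃ K : ℝ, 0 ≤ K ∧ ∀ m, ∀ b ∈ digitSet R B m, ‖(invMap R ^ m) (toVec b)‖ ≤ K := by
  have hsum := (summable_nat_add_iff 1).2 hR.summable_norm_invMap_pow
  set M : ℝ := ∑ b ∈ B, ‖toVec b‖ with hM
  have hM0 : 0 ≤ M := Finset.sum_nonneg (fun _ _ => norm_nonneg _)
  have hstep : ∀ m, ∀ b ∈ digitSet R B m, ‖(invMap R ^ m) (toVec b)‖ ≤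
      (∑ j ∈ Finset.range m, ‖invMap R ^ (j + 1)‖) * M := by
    intro m
    induction m with
    | zero =>
      intro b hb
      rw [digitSet_zero, Finset.mem_zero] at hb
      simp [hb, toVec_zero]
    | succ m ih =>
      intro b hb
      -- Splitting off the lowest digit instead of the highest leaves `R⁻ᵐ b'` with `b'` of level
      -- `m`, so the induction hypothesis applies directly.
      rw [add_comm, digitSet_add, digitSet_succ, digitSet_zero, zero_add, pow_zero, pow_one] at hb
      obtain ⟨x, hx, y, hy, rfl⟩ := Finset.mem_add.1 hb
      obtain ⟨b0, hb0, rfl⟩ := Finset.mem_image.1 hx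
      obtain ⟨b', hb', rfl⟩ := Finset.mem_image.1 hy
      have h1 : (invMap R ^ (m + 1)) (toVec (R.mulVec b')) = (invMap R ^ m) (toVec b') := by
        rw [pow_succ, mul_apply_eq_comp, invMap_toVec_mulVec hR.isUnit_det]
      rw [Matrix.one_mulVec, toVec_add, map_add, h1, Finset.sum_range_succ, add_mul, add_comm]
      refine (norm_add_le _ _).trans (add_le_add (ih b' hb') ?_)
      refine (ContinuousLinearMap.le_opNorm _ _).trans ?_
      gcongr
      exact Finset.single_le_sum (f := fun b => ‖toVec b‖) (fun _ _ => norm_nonneg _) hb0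
  refine ⟨(∑' j, ‖invMap R ^ (j + 1)‖) * M,
    mul_nonneg (tsum_nonneg (fun _ => norm_nonneg _)) hM0, fun m b hb => (hstep m b hb).trans ?_⟩
  gcongr
  exact hsum.sum_le_tsum _ (fun _ _ => norm_nonneg _)

/-- All points `R⁻ᵐ b` lie in one ball, and `μ` is an average of laws of `R⁻ᵐ y + R⁻ᵐ b` with `R⁻ᵐ y
→ 0`, so no mass can lie outside that ball. -/
theorem IsSelfAffineMeasure.exists_ae_norm_le {d : ℕ} {R : Matrix (Fin d) (Fin d) ℤ}
    (hR : IsExpansive R) {B : Finset (Fin d → ℤ)} (hB : B.Nonempty) (hs : IsSimpleDigitSet R B)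
    {μ : Measure (EuclideanSpace ℝ (Fin d))} (hμ : IsSelfAffineMeasure R B μ) :
    ∃ K : ℝ, 0 ≤ K ∧ ∀ᵐ x ∂μ, ‖x‖ ≤ K := by
  have := hμ.isProbabilityMeasure
  obtain ⟨K, hK0, hK⟩ := hR.exists_norm_digit_le B
  refine ⟨K, hK0, ?_⟩
  -- A bounded continuous function positive exactly outside the ball; the truncation at `1` allows
  -- dominated convergence without assuming moments.
  set g : EuclideanSpace ℝ (Fin d) → ℝ := fun x => min 1 (max 0 (‖x‖ - K)) with hgdef
  have hg : Continuous g := by fun_prop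
  have hg0 : ∀ x, 0 ≤ g x := fun x => le_min zero_le_one (le_max_left _ _)
  have hg1 : ∀ x, ‖g x‖ ≤ 1 := fun x => by
    rw [Real.norm_eq_abs, abs_of_nonneg (hg0 x)]; exact min_le_left _ _
  have hint : ∀ m : ℕ, Continuous (fun y => min 1 ‖(invMap R ^ m) y‖) := fun m => by fun_prop
  have hint1 : ∀ (m : ℕ) y, ‖min 1 ‖(invMap R ^ m) y‖‖ ≤ 1 := fun m y => by
    rw [Real.norm_eq_abs, abs_of_nonneg (le_min zero_le_one (norm_nonneg _))]
    exact min_le_left _ _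
  have hNpos : ∀ m : ℕ, (0 : ℝ) < (B.card : ℝ) ^ m :=
    fun m => pow_pos (by exact_mod_cast hB.card_pos) m
  have hle : ∀ m : ℕ, ∫ x, g x ∂μ ≤ ∫ y, min 1 ‖(invMap R ^ m) y‖ ∂μ := by
    intro m
    rw [hμ.integral_eq_digitSet hR.isUnit_det hB hs m hg hg1, smul_eq_mul,
      inv_mul_le_iff₀ (hNpos m)]
    refine (Finset.sum_le_card_nsmul _ _ (∫ y, min 1 ‖(invMap R ^ m) y‖ ∂μ)
      (fun b hb => ?_)).trans (le_of_eq ?_)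
    · refine integral_mono
        (integrable_of_continuous_bounded (by fun_prop) (fun y => hg1 _))
        (integrable_of_continuous_bounded (hint m) (hint1 m)) (fun y => ?_)
      refine min_le_min le_rfl (max_le (norm_nonneg _) ?_)
      have h1 := norm_add_le ((invMap R ^ m) y) ((invMap R ^ m) (toVec b))
      have h2 := hK m b hb
      rw [map_add]
      linarith
    · rw [hs.card_digitSet hR.isUnit_det, nsmul_eq_mul]
      push_cast
      rfl
  have hlim : Tendsto (fun m : ℕ => ∫ y, min 1 ‖(invMap R ^ m) y‖ ∂μ) atTop (𝓝 0) := by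
    have h0 := tendsto_integral_of_dominated_convergence (μ := μ)
      (F := fun (m : ℕ) y => min 1 ‖(invMap R ^ m) y‖) (f := fun _ => (0 : ℝ)) (fun _ => (1 : ℝ))
      (fun m => (hint m).aestronglyMeasurable) (integrable_const _)
      (fun m => ae_of_all _ (hint1 m)) (ae_of_all _ (fun y => ?_))
    · simpa using h0
    · have h1 : Tendsto (fun m : ℕ => ‖invMap R ^ m‖ * ‖y‖) atTop (𝓝 0) := by
        simpa using hR.summable_norm_invMap_pow.tendsto_atTop_zero.mul_const ‖y‖
      exact squeeze_zero (fun m => le_min zero_le_one (norm_nonneg _))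
        (fun m => (min_le_right _ _).trans (ContinuousLinearMap.le_opNorm _ _)) h1
  have hzero : ∫ x, g x ∂μ = 0 :=
    le_antisymm (ge_of_tendsto' hlim hle) (integral_nonneg hg0)
  rw [integral_eq_zero_iff_of_nonneg hg0 (integrable_of_continuous_bounded hg hg1)] at hzero
  filter_upwards [hzero] with x hx
  by_contra hlt
  push Not at hlt
  have : 0 < g x := lt_min zero_lt_one (lt_max_of_lt_right (by linarith))
  exact this.ne' hx

/-- Riemann sums over the digit sets, weighted by the mass of a second function on the cells,
converge uniformly in that second function. -/
theorem IsSelfAffineMeasure.eventually_norm_sum_sub_integral_le {d : ℕ}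
    {R : Matrix (Fin d) (Fin d) ℤ} (hR : IsExpansive R) {B : Finset (Fin d → ℤ)}
    (hB : B.Nonempty) (hs : IsSimpleDigitSet R B) {μ : Measure (EuclideanSpace ℝ (Fin d))}
    (hμ : IsSelfAffineMeasure R B μ) {h : EuclideanSpace ℝ (Fin d) → ℂ}
    (hh : UniformContinuous h) {C : ℝ} (hC : ∀ x, ‖h x‖ ≤ C) {η : ℝ} (hη : 0 < η) :
    ∀ᶠ m in atTop, ∀ (g : EuclideanSpace ℝ (Fin d) → ℂ) (D : ℝ), Continuous g →
      (∀ x, ‖g x‖ ≤ D) →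
      ‖((B.card : ℝ) ^ m)⁻¹ • ∑ b ∈ digitSet R B m, h ((invMap R ^ m) (toVec b)) *
          ∫ y, g ((invMap R ^ m) (y + toVec b)) ∂μ - ∫ x, h x * g x ∂μ‖ ≤ η * ∫ x, ‖g x‖ ∂μ := by
  have := hμ.isProbabilityMeasure
  obtain ⟨K, hK0, hK⟩ := hμ.exists_ae_norm_le hR hB hs
  obtain ⟨δ, hδ, hhδ⟩ := Metric.uniformContinuous_iff.1 hh η hη
  have h1 : Tendsto (fun m : ℕ => ‖invMap R ^ m‖ * K) atTop (𝓝 0) := by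
    simpa using hR.summable_norm_invMap_pow.tendsto_atTop_zero.mul_const K
  -- The level depends only on the modulus of continuity of `h`, so it is fixed before `g` is
  -- introduced.
  filter_upwards [h1.eventually_lt_const hδ] with m hm g D hg hD
  have hC0 : 0 ≤ C := (norm_nonneg _).trans (hC 0)
  have hNpos : (0 : ℝ) < (B.card : ℝ) ^ m := pow_pos (by exact_mod_cast hB.card_pos) m
  have hhc := hh.continuous
  rw [hμ.integral_eq_digitSet hR.isUnit_det hB hs m (g := fun x => h x * g x) (C := C * D)
      (hhc.mul hg) (fun x => by
        rw [norm_mul]; exact mul_le_mul (hC x) (hD x) (norm_nonneg _) hC0),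
    hμ.integral_eq_digitSet hR.isUnit_det hB hs m (g := fun x => ‖g x‖) (C := D)
      hg.norm (fun x => by rw [norm_norm]; exact hD x), ← smul_sub, ← Finset.sum_sub_distrib,
    norm_smul, norm_inv, norm_pow, Real.norm_natCast, smul_eq_mul, mul_left_comm]
  refine mul_le_mul_of_nonneg_left ?_ (inv_nonneg.2 hNpos.le)
  rw [Finset.mul_sum]
  refine norm_sum_le_of_le _ (fun b _ => ?_)
  rw [← integral_const_mul, ← integral_const_mul, ← integral_sub]
  · refine norm_integral_le_of_norm_le
      ((integrable_of_continuous_bounded (C := D) (by fun_prop)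
        (fun x => by rw [norm_norm]; exact hD _)).const_mul η) ?_
    filter_upwards [hK] with y hy
    rw [← sub_mul, norm_mul]
    refine mul_le_mul_of_nonneg_right ?_ (norm_nonneg _)
    rw [← dist_eq_norm]
    refine (hhδ ?_).le
    rw [map_add, dist_comm, dist_eq_norm, add_sub_cancel_right]
    exact ((ContinuousLinearMap.le_opNorm _ _).trans
      (mul_le_mul_of_nonneg_left hy (norm_nonneg _))).trans_lt hm
  · exact (integrable_of_continuous_bounded (C := D) (by fun_prop) (fun x => hD _)).const_mul _
  · refine integrable_of_continuous_bounded (C := C * D) (by fun_prop) (fun x => ?_)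
    rw [norm_mul]
    exact mul_le_mul (hC _) (hD _) (norm_nonneg _) hC0

/-! ### Bessel sequences in Hilbert spaces -/

section Bessel

theorem bessel_of_dense {ι H : Type*} [NormedAddCommGroup H] [InnerProductSpace ℂ H]
    {E : ι → H} {C : ℝ} {D : Set H} (hD : Dense D) {G : Finset ι}
    (h : ∀ f ∈ D, ∑ i ∈ G, ‖inner ℂ (E i) f‖ ^ 2 ≤ C * ‖f‖ ^ 2)
    (f : H) : ∑ i ∈ G, ‖inner ℂ (E i) f‖ ^ 2 ≤ C * ‖f‖ ^ 2 := by
  have hcl : IsClosed {f : H | ∑ i ∈ G, ‖inner ℂ (E i) f‖ ^ 2 ≤ C * ‖f‖ ^ 2} :=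
    isClosed_le (by fun_prop) (by fun_prop)
  exact hcl.closure_subset_iff.2 h (hD f)

/-- The synthesis operator is adjoint to the analysis operator and has the same norm: pair the
combination with itself and apply Cauchy–Schwarz. -/
theorem norm_sq_sum_smul_le_of_bessel {ι H : Type*} [NormedAddCommGroup H]
    [InnerProductSpace ℂ H] {E : ι → H} {C : ℝ} (hC : 0 ≤ C) {G : Finset ι}
    (h : ∀ f, ∑ i ∈ G, ‖inner ℂ (E i) f‖ ^ 2 ≤ C * ‖f‖ ^ 2) (c : ι → ℂ) :
    ‖∑ i ∈ G, c i • E i‖ ^ 2 ≤ C * ∑ i ∈ G, ‖c i‖ ^ 2 := by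
  set p := ∑ i ∈ G, c i • E i with hp
  have h1 : ‖p‖ ^ 2 ≤ ∑ i ∈ G, ‖c i‖ * ‖inner ℂ (E i) p‖ := by
    have h2 : ‖inner ℂ p p‖ = ‖p‖ ^ 2 := by
      rw [inner_self_eq_norm_sq_to_K]; simp
    rw [← h2]
    conv_lhs => rw [hp, sum_inner, ← hp]
    refine norm_sum_le_of_le _ (fun i _ => ?_)
    rw [inner_smul_left, norm_mul, RCLike.norm_conj]
  have h3 : (∑ i ∈ G, ‖c i‖ * ‖inner ℂ (E i) p‖) ^ 2 ≤
      (∑ i ∈ G, ‖c i‖ ^ 2) * (C * ‖p‖ ^ 2) :=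
    (Finset.sum_mul_sq_le_sq_mul_sq _ _ _).trans
      (mul_le_mul_of_nonneg_left (h p) (Finset.sum_nonneg (fun _ _ => sq_nonneg _)))
  have h4 : (‖p‖ ^ 2) ^ 2 ≤ (∑ i ∈ G, ‖c i‖ ^ 2) * (C * ‖p‖ ^ 2) :=
    (pow_le_pow_left₀ (sq_nonneg _) h1 2).trans h3
  rcases eq_or_ne (‖p‖ ^ 2) 0 with h0 | h0
  · rw [h0]
    exact mul_nonneg hC (Finset.sum_nonneg (fun _ _ => sq_nonneg _))
  · have hpos : 0 < ‖p‖ ^ 2 := lt_of_le_of_ne (sq_nonneg _) (Ne.symm h0)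
    nlinarith

theorem summable_of_bessel {ι H : Type*} [NormedAddCommGroup H] [InnerProductSpace ℂ H]
    {E : ι → H} {C : ℝ}
    (h : ∀ f, ∀ G : Finset ι, ∑ i ∈ G, ‖inner ℂ (E i) f‖ ^ 2 ≤ C * ‖f‖ ^ 2) (f : H) :
    Summable (fun i => ‖inner ℂ (E i) f‖ ^ 2) :=
  summable_of_sum_le (fun _ => sq_nonneg _) (h f)

theorem continuous_tsum_of_bessel {ι H : Type*} [NormedAddCommGroup H] [InnerProductSpace ℂ H]
    {E : ι → H} {C : ℝ}
    (h : ∀ f, ∀ G : Finset ι, ∑ i ∈ G, ‖inner ℂ (E i) f‖ ^ 2 ≤ C * ‖f‖ ^ 2) :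
    Continuous (fun f => ∑' i, ‖inner ℂ (E i) f‖ ^ 2) := by
  have h2 : (0 : ℝ) < (2 : ℝ≥0∞).toReal := by norm_num
  -- The analysis operator into `ℓ²`; its boundedness gives the continuity of the infinite sum.
  let L : H →ₗ[ℂ] lp (fun _ : ι => ℂ) 2 :=
    { toFun := fun f => ⟨fun i => inner ℂ (E i) f,
        (memℓp_gen_iff h2).2 (by simpa using summable_of_bessel h f)⟩
      map_add' := fun f g => lp.ext (funext fun i => inner_add_right _ _ _)
      map_smul' := fun c f => lp.ext (funext fun i => inner_smul_right _ _ _) }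
  have hL : ∀ f, ‖L f‖ ^ 2 = ∑' i, ‖inner ℂ (E i) f‖ ^ 2 := by
    intro f
    have := lp.norm_rpow_eq_tsum h2 (L f)
    simpa [L] using this
  have hb : ∀ f, ‖L f‖ ≤ Real.sqrt C * ‖f‖ := by
    intro f
    have h1 : ‖L f‖ ^ 2 ≤ C * ‖f‖ ^ 2 := by
      rw [hL]; exact (summable_of_bessel h f).tsum_le_of_sum_le (h f)
    have h3 := Real.sqrt_le_sqrt h1
    rwa [Real.sqrt_sq (norm_nonneg _), Real.sqrt_mul' _ (sq_nonneg _),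
      Real.sqrt_sq (norm_nonneg _)] at h3
  have hc : Continuous (fun f => ‖(L.mkContinuous _ hb) f‖ ^ 2) := by fun_prop
  simpa [hL] using hc

theorem lower_bound_of_dense {ι H : Type*} [NormedAddCommGroup H] [InnerProductSpace ℂ H]
    {E : ι → H} {C a : ℝ}
    (h : ∀ f, ∀ G : Finset ι, ∑ i ∈ G, ‖inner ℂ (E i) f‖ ^ 2 ≤ C * ‖f‖ ^ 2)
    {D : Set H} (hD : Dense D) (ha : ∀ f ∈ D, a * ‖f‖ ^ 2 ≤ ∑' i, ‖inner ℂ (E i) f‖ ^ 2) (f : H) :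
    a * ‖f‖ ^ 2 ≤ ∑' i, ‖inner ℂ (E i) f‖ ^ 2 := by
  have hcl : IsClosed {f : H | a * ‖f‖ ^ 2 ≤ ∑' i, ‖inner ℂ (E i) f‖ ^ 2} :=
    isClosed_le (by fun_prop) (continuous_tsum_of_bessel h)
  exact hcl.closure_subset_iff.2 ha (hD f)

/-- A Parseval frame of unit vectors is an orthonormal basis. -/
theorem exists_hilbertBasis_of_parseval {ι H : Type*} [NormedAddCommGroup H]
    [InnerProductSpace ℂ H] [CompleteSpace H] {E : ι → H}
    (h : ∀ f, HasSum (fun i => ‖inner ℂ (E i) f‖ ^ 2) (‖f‖ ^ 2)) (h1 : ∀ i, ‖E i‖ = 1) :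
    ∃ b : HilbertBasis ι ℂ H, ⇑b = E := by
  classical
  have hon : Orthonormal ℂ E := by
    refine ⟨h1, fun i j hij => ?_⟩
    -- In the Parseval identity for `E j` the `j`-th term alone already equals the total `1`.
    have h2 := sum_le_hasSum {i, j} (fun _ _ => sq_nonneg _) (h (E j))
    rw [Finset.sum_pair hij, inner_self_eq_norm_sq_to_K, h1] at h2
    simp only [RCLike.ofReal_one, one_pow, norm_one] at h2
    have h3 : ‖inner ℂ (E i) (E j)‖ ^ 2 = 0 := le_antisymm (by linarith) (sq_nonneg _)
    simpa using h3
  have hsp : (Submodule.span ℂ (Set.range E))ᗮ = ⊥ := by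
    rw [Submodule.eq_bot_iff]
    intro f hf
    have h2 : ∀ i, inner ℂ (E i) f = 0 := fun i =>
      (Submodule.mem_orthogonal _ _).1 hf _ (Submodule.subset_span ⟨i, rfl⟩)
    have h3 := h f
    simp only [h2, norm_zero, ne_eq, OfNat.ofNat_ne_zero, not_false_eq_true, zero_pow] at h3
    have h4 := h3.unique hasSum_zero
    simpa using h4
  exact ⟨HilbertBasis.mkOfOrthogonalEqBot hon hsp, HilbertBasis.coe_mkOfOrthogonalEqBot hon hsp⟩

end Bessel

/-! ### Exponentials in `L²(μ)` -/

/-- The exponential `e_ξ` as an element of `L²(μ)`. -/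
noncomputable def expLp {d : ℕ} (μ : Measure (EuclideanSpace ℝ (Fin d))) [IsFiniteMeasure μ]
    (ξ : EuclideanSpace ℝ (Fin d)) : Lp ℂ 2 μ :=
  (memLp_expFun μ ξ).toLp (expFun ξ)

theorem inner_expLp {d : ℕ} (μ : Measure (EuclideanSpace ℝ (Fin d))) [IsFiniteMeasure μ]
    (ξ : EuclideanSpace ℝ (Fin d)) (f : Lp ℂ 2 μ) :
    inner ℂ (expLp μ ξ) f = fourierCoefficient μ f ξ := by
  rw [L2.inner_def, fourierCoefficient]
  refine integral_congr_ae ?_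
  filter_upwards [(memLp_expFun μ ξ).coeFn_toLp] with x hx
  rw [expLp, hx, RCLike.inner_apply, conj_expFun]
  rfl

theorem fourierCoefficient_toLp {d : ℕ} {μ : Measure (EuclideanSpace ℝ (Fin d))}
    {f : EuclideanSpace ℝ (Fin d) → ℂ} (hf : MemLp f 2 μ) (ξ : EuclideanSpace ℝ (Fin d)) :
    fourierCoefficient μ (hf.toLp f) ξ = fourierCoefficient μ f ξ := by
  refine integral_congr_ae ?_
  filter_upwards [hf.coeFn_toLp] with x hx
  rw [hx]

theorem norm_toLp_sq {d : ℕ} {μ : Measure (EuclideanSpace ℝ (Fin d))}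
    {f : EuclideanSpace ℝ (Fin d) → ℂ} (hf : MemLp f 2 μ) :
    ‖hf.toLp f‖ ^ 2 = ∫ x, ‖f x‖ ^ 2 ∂μ := by
  have h1 : inner ℂ (hf.toLp f) (hf.toLp f) = ((∫ x, ‖f x‖ ^ 2 ∂μ : ℝ) : ℂ) := by
    rw [L2.inner_def, ← integral_complex_ofReal]
    refine integral_congr_ae ?_
    filter_upwards [hf.coeFn_toLp] with x hx
    rw [hx, inner_self_eq_norm_sq_to_K]
    simp
  rw [inner_self_eq_norm_sq_to_K] at h1
  exact Complex.ofReal_injective (by rw [← h1]; simp)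

theorem norm_expLp {d : ℕ} (μ : Measure (EuclideanSpace ℝ (Fin d))) [IsProbabilityMeasure μ]
    (ξ : EuclideanSpace ℝ (Fin d)) : ‖expLp μ ξ‖ = 1 := by
  have h1 := norm_toLp_sq (memLp_expFun μ ξ)
  have h2 : ∀ x, ‖expFun ξ x‖ = 1 := fun x => by
    rw [← norm_negExp ξ x, ← conj_expFun, RCLike.norm_conj]
  simp only [h2, one_pow, integral_const, probReal_univ, smul_eq_mul, mul_one] at h1
  have h3 : (0 : ℝ) ≤ ‖expLp μ ξ‖ := norm_nonneg _
  unfold expLp at h3 ⊢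
  exact (pow_eq_one_iff_of_nonneg h3 two_ne_zero).1 h1

theorem exists_toLp_eq_sum_expLp {d : ℕ} (μ : Measure (EuclideanSpace ℝ (Fin d)))
    [IsFiniteMeasure μ] {ι : Type*} (ξ : ι → EuclideanSpace ℝ (Fin d)) (c : ι → ℂ)
    (G : Finset ι) :
    ∃ h : MemLp (fun x => ∑ i ∈ G, c i * expFun (ξ i) x) 2 μ,
      h.toLp _ = ∑ i ∈ G, c i • expLp μ (ξ i) := by
  classical
  induction G using Finset.induction_on with
  | empty =>
    simp only [Finset.sum_empty]
    exact ⟨MemLp.zero, rfl⟩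
  | insert i G hi ih =>
    obtain ⟨h, hh⟩ := ih
    simp only [Finset.sum_insert hi]
    refine ⟨((memLp_expFun μ (ξ i)).const_smul (c i)).add h, ?_⟩
    rw [← hh, expLp, ← MemLp.toLp_const_smul]
    rfl

theorem dense_toLp_hasCompactSupport {d : ℕ} (μ : Measure (EuclideanSpace ℝ (Fin d)))
    [IsFiniteMeasure μ] :
    Dense {F : Lp ℂ 2 μ | ∃ (f : EuclideanSpace ℝ (Fin d) → ℂ) (hf : MemLp f 2 μ),
      Continuous f ∧ HasCompactSupport f ∧ F = hf.toLp f} := by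
  rw [EMetric.dense_iff]
  intro F r hr
  obtain ⟨r', hr'0, hr'⟩ := exists_between hr
  obtain ⟨f, hf1, hf2, hf3, hf4⟩ :=
    (Lp.memLp F).exists_hasCompactSupport_eLpNorm_sub_le (by norm_num) hr'0.ne'
  refine ⟨hf4.toLp f, ?_, f, hf4, hf3, hf1, rfl⟩
  rw [Metric.mem_eball, edist_comm]
  refine lt_of_le_of_lt ?_ hr'
  conv_lhs => rw [← Lp.toLp_coeFn F (Lp.memLp F)]
  rwa [Lp.edist_toLp_toLp]

/-! ### Discretized Fourier coefficients -/

/-- The Riemann sum over the `m`-th level digit set for the Fourier coefficient of `f` at `ξ`. -/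
noncomputable def discreteCoefficient {d : ℕ} (R : Matrix (Fin d) (Fin d) ℤ)
    (B : Finset (Fin d → ℤ)) (f : EuclideanSpace ℝ (Fin d) → ℂ) (m : ℕ)
    (ξ : EuclideanSpace ℝ (Fin d)) : ℂ :=
  ((B.card : ℝ) ^ m)⁻¹ • ∑ b ∈ digitSet R B m,
    f ((invMap R ^ m) (toVec b)) * negExp ξ ((invMap R ^ m) (toVec b))

theorem HasSamplingBounds.discreteCoefficient {d : ℕ} {R : Matrix (Fin d) (Fin d) ℤ}
    {B : Finset (Fin d → ℤ)} (hB : B.Nonempty) {m : ℕ} {L : Finset (Fin d → ℤ)} {a b : ℝ}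
    (h : HasSamplingBounds R B m L a b) (f : EuclideanSpace ℝ (Fin d) → ℂ) :
    a * (((B.card : ℝ) ^ m)⁻¹ * ∑ b ∈ digitSet R B m, ‖f ((invMap R ^ m) (toVec b))‖ ^ 2) ≤
      ∑ l ∈ L, ‖discreteCoefficient R B f m (toVec l)‖ ^ 2 ∧
    ∑ l ∈ L, ‖_root_.discreteCoefficient R B f m (toVec l)‖ ^ 2 ≤
      b * (((B.card : ℝ) ^ m)⁻¹ *
        ∑ b ∈ digitSet R B m, ‖f ((invMap R ^ m) (toVec b))‖ ^ 2) := by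
  have hN : (0 : ℝ) < (B.card : ℝ) ^ m := pow_pos (by exact_mod_cast hB.card_pos) m
  -- The Riemann sum carries `N⁻ᵐ` where the sampling bounds carry `N^(-m/2)`. The leftover `N⁻ᵐ`
  -- after squaring turns the `ℓ²` norm of the samples into a Riemann sum for `∫ ‖f‖²`.
  have hterm : ∀ l : Fin d → ℤ, ‖_root_.discreteCoefficient R B f m (toVec l)‖ ^ 2 =
      ((B.card : ℝ) ^ m)⁻¹ * ‖((1 / Real.sqrt ((B.card : ℝ) ^ m) : ℝ) : ℂ) *
        ∑ b ∈ digitSet R B m, f ((invMap R ^ m) (toVec b)) *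
          negExp (toVec l) ((invMap R ^ m) (toVec b))‖ ^ 2 := by
    intro l
    rw [_root_.discreteCoefficient, norm_smul, norm_mul, Complex.norm_real, mul_pow, mul_pow,
      Real.norm_eq_abs, sq_abs, Real.norm_eq_abs, sq_abs, div_pow, Real.sq_sqrt hN.le]
    ring
  obtain ⟨h1, h2⟩ := h (fun b => f ((invMap R ^ m) (toVec b)))
  simp only [hterm, ← Finset.mul_sum]
  constructor
  · rw [mul_left_comm]
    exact mul_le_mul_of_nonneg_left h1 (inv_nonneg.2 hN.le)
  · rw [mul_left_comm b]
    exact mul_le_mul_of_nonneg_left h2 (inv_nonneg.2 hN.le)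

theorem IsSelfAffineMeasure.tendsto_sum_digitSet {d : ℕ}
    {R : Matrix (Fin d) (Fin d) ℤ} (hR : IsExpansive R) {B : Finset (Fin d → ℤ)}
    (hB : B.Nonempty) (hs : IsSimpleDigitSet R B) {μ : Measure (EuclideanSpace ℝ (Fin d))}
    (hμ : IsSelfAffineMeasure R B μ) {h : EuclideanSpace ℝ (Fin d) → ℂ}
    (hh : Continuous h) (hc : HasCompactSupport h) :
    Tendsto (fun m : ℕ => ((B.card : ℝ) ^ m)⁻¹ • ∑ b ∈ digitSet R B m,
      h ((invMap R ^ m) (toVec b))) atTop (𝓝 (∫ x, h x ∂μ)) := by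
  have := hμ.isProbabilityMeasure
  obtain ⟨C, hC⟩ := hc.exists_bound_of_continuous hh
  rw [Metric.tendsto_nhds]
  intro η hη
  filter_upwards [hμ.eventually_norm_sum_sub_integral_le hR hB hs
    (hc.uniformContinuous_of_continuous hh) hC (half_pos hη)] with m hm
  have h1 := hm (fun _ => 1) 1 continuous_const (fun _ => by simp)
  simp only [integral_const, probReal_univ, one_smul, mul_one, norm_one] at h1
  rw [dist_eq_norm]
  linarith

section Approximation

variable {d : ℕ} {R : Matrix (Fin d) (Fin d) ℤ} {B : Finset (Fin d → ℤ)}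
  {μ : Measure (EuclideanSpace ℝ (Fin d))} {f : EuclideanSpace ℝ (Fin d) → ℂ}

theorem IsSelfAffineMeasure.tendsto_discreteCoefficient (hR : IsExpansive R)
    (hB : B.Nonempty) (hs : IsSimpleDigitSet R B) (hμ : IsSelfAffineMeasure R B μ)
    (hf : Continuous f) (hc : HasCompactSupport f) (ξ : EuclideanSpace ℝ (Fin d)) :
    Tendsto (fun m => discreteCoefficient R B f m ξ) atTop (𝓝 (fourierCoefficient μ f ξ)) :=
  hμ.tendsto_sum_digitSet hR hB hs (h := fun x => f x * negExp ξ x)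
    (hf.mul (continuous_negExp ξ)) hc.mul_right

theorem IsSelfAffineMeasure.tendsto_sum_norm_sq (hR : IsExpansive R)
    (hB : B.Nonempty) (hs : IsSimpleDigitSet R B) (hμ : IsSelfAffineMeasure R B μ)
    (hf : Continuous f) (hc : HasCompactSupport f) :
    Tendsto (fun m : ℕ => ((B.card : ℝ) ^ m)⁻¹ *
      ∑ b ∈ digitSet R B m, ‖f ((invMap R ^ m) (toVec b))‖ ^ 2) atTop
      (𝓝 (∫ x, ‖f x‖ ^ 2 ∂μ)) := by
  have h1 := hμ.tendsto_sum_digitSet hR hB hs (h := fun x => ((‖f x‖ ^ 2 : ℝ) : ℂ))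
    (by fun_prop) (hc.comp_left (g := fun z : ℂ => ((‖z‖ ^ 2 : ℝ) : ℂ)) (by simp))
  rw [integral_complex_ofReal] at h1
  have h2 := (Complex.continuous_re.tendsto _).comp h1
  rw [Complex.ofReal_re] at h2
  refine h2.congr (fun m => ?_)
  simp only [Function.comp_apply, Complex.smul_re, Complex.re_sum, Complex.ofReal_re, smul_eq_mul]

/-- Exponentials are characters, so the translation comes out of the integral. This is where the
values of `μ̂` entering `δ(Λ)` appear. -/
theorem integral_negExp_cell (m : ℕ) (l b : Fin d → ℤ) :
    ∫ y, negExp (toVec l) ((invMap R ^ m) (y + toVec b)) ∂μ =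
      negExp (toVec l) ((invMap R ^ m) (toVec b)) *
        measureFourier μ ((invTransposeMap R ^ m) (toVec l)) := by
  rw [measureFourier, ← integral_const_mul]
  refine integral_congr_ae (ae_of_all _ (fun y => ?_))
  simp only [map_add, negExp_add_right, inner_invTransposeMap_pow]
  rw [mul_comm]
  rfl

/-- Nonnegativity of the variance of `‖g‖`. -/
theorem sq_integral_norm_le [IsProbabilityMeasure μ] {g : EuclideanSpace ℝ (Fin d) → ℂ}
    (hg : Continuous g) {D : ℝ} (hD : ∀ x, ‖g x‖ ≤ D) :
    (∫ x, ‖g x‖ ∂μ) ^ 2 ≤ ∫ x, ‖g x‖ ^ 2 ∂μ := by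
  set t := ∫ x, ‖g x‖ ∂μ with ht
  have hi1 : Integrable (fun x => ‖g x‖) μ :=
    integrable_of_continuous_bounded hg.norm (fun x => by rw [norm_norm]; exact hD x)
  have hi2 : Integrable (fun x => ‖g x‖ ^ 2) μ :=
    integrable_of_continuous_bounded (C := D ^ 2) (by fun_prop) (fun x => by
      rw [norm_pow, norm_norm]; exact pow_le_pow_left₀ (norm_nonneg _) (hD x) 2)
  have h0 : 0 ≤ ∫ x, (‖g x‖ - t) ^ 2 ∂μ := integral_nonneg (fun _ => sq_nonneg _)
  have h1 : ∫ x, (‖g x‖ - t) ^ 2 ∂μ = ∫ x, (‖g x‖ ^ 2 - 2 * t * ‖g x‖ + t ^ 2) ∂μ :=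
    integral_congr_ae (ae_of_all _ (fun x => by ring))
  rw [h1, integral_add (f := fun x => ‖g x‖ ^ 2 - 2 * t * ‖g x‖) (hi2.sub (hi1.const_mul _))
    (integrable_const _), integral_sub hi2 (hi1.const_mul _), integral_const_mul, ← ht] at h0
  simp only [integral_const, probReal_univ, one_smul] at h0
  nlinarith

/-- The discretized coefficients, corrected by the Fourier transform of the measure, approximate
the Fourier coefficients in `ℓ²` along any finite Bessel family, uniformly in the family. -/
theorem IsSelfAffineMeasure.eventually_sum_norm_sub_sq_le [IsProbabilityMeasure μ]
    (hR : IsExpansive R)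
    (hB : B.Nonempty) (hs : IsSimpleDigitSet R B) (hμ : IsSelfAffineMeasure R B μ)
    (hf : Continuous f) (hc : HasCompactSupport f) {C : ℝ} (hC : 0 ≤ C) {η : ℝ} (hη : 0 < η) :
    ∀ᶠ m in atTop, ∀ G : Finset (Fin d → ℤ),
      (∀ F : Lp ℂ 2 μ, ∑ l ∈ G, ‖inner ℂ (expLp μ (toVec l)) F‖ ^ 2 ≤ C * ‖F‖ ^ 2) →
      ∑ l ∈ G, ‖discreteCoefficient R B f m (toVec l) *
        measureFourier μ ((invTransposeMap R ^ m) (toVec l)) -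
          fourierCoefficient μ f (toVec l)‖ ^ 2 ≤ C * η ^ 2 := by
  obtain ⟨K, hK⟩ := hc.exists_bound_of_continuous hf
  filter_upwards [hμ.eventually_norm_sum_sub_integral_le hR hB hs
    (hc.uniformContinuous_of_continuous hf) hK hη] with m hm G hG
  set c : (Fin d → ℤ) → ℂ := fun l => discreteCoefficient R B f m (toVec l) *
        measureFourier μ ((invTransposeMap R ^ m) (toVec l)) -
          fourierCoefficient μ f (toVec l)
  set T : ℝ := ∑ l ∈ G, ‖c l‖ ^ 2 with hT
  have hT0 : 0 ≤ T := Finset.sum_nonneg (fun _ _ => sq_nonneg _)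
  -- Duality: `c` is the error vector, and `g` is chosen so that the Riemann sum error for `f * g`
  -- is exactly `T = ∑ ‖c l‖²`.
  set g : EuclideanSpace ℝ (Fin d) → ℂ :=
    fun x => ∑ l ∈ G, (starRingEnd ℂ) (c l) * negExp (toVec l) x with hg
  have hgc : Continuous g :=
    continuous_finsetSum _ (fun l _ => continuous_const.mul (continuous_negExp _))
  have hgD : ∀ x, ‖g x‖ ≤ ∑ l ∈ G, ‖c l‖ := fun x =>
    norm_sum_le_of_le _ (fun l _ => by rw [norm_mul, norm_negExp, mul_one, RCLike.norm_conj])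
  have h1 := hm g _ hgc hgD
  have hcell : ∀ b, ∫ y, g ((invMap R ^ m) (y + toVec b)) ∂μ =
      ∑ l ∈ G, (starRingEnd ℂ) (c l) * (negExp (toVec l) ((invMap R ^ m) (toVec b)) *
        measureFourier μ ((invTransposeMap R ^ m) (toVec l))) := by
    intro b
    simp only [hg]
    rw [integral_finsetSum]
    · refine Finset.sum_congr rfl (fun l _ => ?_)
      rw [integral_const_mul, integral_negExp_cell]
    · intro l _
      exact (integrable_of_continuous_bounded (C := 1)
        ((continuous_negExp _).comp (by fun_prop)) (fun x => (norm_negExp _ _).le)).const_mul _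
  have hfull : ∫ x, f x * g x ∂μ =
      ∑ l ∈ G, (starRingEnd ℂ) (c l) * fourierCoefficient μ f (toVec l) := by
    simp only [hg, Finset.mul_sum]
    rw [integral_finsetSum]
    · refine Finset.sum_congr rfl (fun l _ => ?_)
      rw [fourierCoefficient, ← integral_const_mul]
      refine integral_congr_ae (ae_of_all _ (fun x => ?_))
      simp only [negExp]
      ring
    · intro l _
      refine integrable_of_continuous_bounded (C := K * ‖c l‖)
        (hf.mul (continuous_const.mul (continuous_negExp _))) (fun x => ?_)
      rw [norm_mul, norm_mul, norm_negExp, mul_one, RCLike.norm_conj]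
      exact mul_le_mul_of_nonneg_right (hK x) (norm_nonneg _)
  have hval : ((B.card : ℝ) ^ m)⁻¹ • ∑ b ∈ digitSet R B m, f ((invMap R ^ m) (toVec b)) *
          ∫ y, g ((invMap R ^ m) (y + toVec b)) ∂μ - ∫ x, f x * g x ∂μ = (T : ℂ) := by
    rw [hfull, hT]
    simp only [hcell, Finset.mul_sum]
    rw [Finset.sum_comm, Finset.smul_sum, ← Finset.sum_sub_distrib, Complex.ofReal_sum]
    refine Finset.sum_congr rfl (fun l _ => ?_)
    have h2 : ((‖c l‖ ^ 2 : ℝ) : ℂ) = (starRingEnd ℂ) (c l) * c l := by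
      rw [Complex.conj_mul']; push_cast; rfl
    have h3 : c l = discreteCoefficient R B f m (toVec l) *
        measureFourier μ ((invTransposeMap R ^ m) (toVec l)) -
          fourierCoefficient μ f (toVec l) := rfl
    rw [h2]
    generalize (starRingEnd ℂ) (c l) = z
    rw [h3, mul_sub, discreteCoefficient, smul_mul_assoc, mul_smul_comm, Finset.sum_mul,
      Finset.mul_sum]
    congr 2
    refine Finset.sum_congr rfl (fun b _ => ?_)
    ring
  rw [hval, Complex.norm_real, Real.norm_eq_abs, abs_of_nonneg hT0] at h1
  obtain ⟨hp, hpeq⟩ := exists_toLp_eq_sum_expLp μ (fun l : Fin d → ℤ => toVec l) c G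
  have h2 := norm_sq_sum_smul_le_of_bessel hC hG c
  rw [← hpeq, norm_toLp_sq] at h2
  -- `g` is the pointwise conjugate of the synthesized function, so the dual Bessel bound gives `∫
  -- ‖g‖² ≤ C * T`. With `T ≤ η * ∫ ‖g‖` this yields `T² ≤ η² * C * T`.
  have h3 : ∫ x, ‖∑ l ∈ G, c l * expFun (toVec l) x‖ ^ 2 ∂μ = ∫ x, ‖g x‖ ^ 2 ∂μ := by
    refine integral_congr_ae (ae_of_all _ (fun x => ?_))
    simp only [hg]
    rw [← RCLike.norm_conj, map_sum]
    simp only [map_mul, conj_expFun]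
  rw [h3] at h2
  have h4 : (∫ x, ‖g x‖ ∂μ) ^ 2 ≤ C * T := (sq_integral_norm_le hgc hgD).trans h2
  have h5 : T ^ 2 ≤ η ^ 2 * (C * T) := by
    refine (pow_le_pow_left₀ hT0 h1 2).trans ?_
    rw [mul_pow]
    exact mul_le_mul_of_nonneg_left h4 (sq_nonneg _)
  rcases hT0.eq_or_lt with h0 | h0
  · rw [← h0]; positivity
  · nlinarith

end Approximation

/-! ### Frames from sampling bounds at increasing levels -/

section Frame

variable {d : ℕ} {R : Matrix (Fin d) (Fin d) ℤ} {B : Finset (Fin d → ℤ)}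
  {μ : Measure (EuclideanSpace ℝ (Fin d))} {m : ℕ → ℕ} {L : ℕ → Finset (Fin d → ℤ)}
  {α β : ℕ → ℝ} {a b δ : ℝ}

theorem eventually_subset_of_monotone {X : Type*} {L : ℕ → Finset X} (hL : Monotone L)
    {G : Finset X} (hG : ∀ l ∈ G, ∃ k, l ∈ L k) : ∀ᶠ k in atTop, G ⊆ L k := by
  have h1 : ∀ᶠ k in atTop, ∀ l ∈ G, l ∈ L k := by
    rw [Filter.eventually_all_finset]
    intro l hl
    obtain ⟨k0, hk0⟩ := hG l hl
    filter_upwards [eventually_ge_atTop k0] with k hk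
    exact hL hk hk0
  exact h1

/-- For a fixed finite `G`, eventually contained in `L k`, the discrete upper bounds pass to the
limit; no lower bound on `μ̂` is needed. -/
theorem IsSelfAffineMeasure.bessel_of_hasSamplingBounds (hR : IsExpansive R)
    (hB : B.Nonempty) (hs : IsSimpleDigitSet R B) (hμ : IsSelfAffineMeasure R B μ)
    [IsProbabilityMeasure μ]
    (hm : Tendsto m atTop atTop) (hL : Monotone L)
    (hsamp : ∀ k, HasSamplingBounds R B (m k) (L k) (α k) (β k))
    (hβ : Tendsto β atTop (𝓝 b)) {G : Finset (Fin d → ℤ)} (hG : ∀ l ∈ G, ∃ k, l ∈ L k)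
    (F : Lp ℂ 2 μ) :
    ∑ l ∈ G, ‖inner ℂ (expLp μ (toVec l)) F‖ ^ 2 ≤ b * ‖F‖ ^ 2 := by
  refine bessel_of_dense (dense_toLp_hasCompactSupport μ) ?_ F
  rintro _ ⟨f, hf, hfc, hfs, rfl⟩
  simp only [inner_expLp, fourierCoefficient_toLp, norm_toLp_sq]
  have h1 : Tendsto (fun k => ∑ l ∈ G, ‖discreteCoefficient R B f (m k) (toVec l)‖ ^ 2) atTop
      (𝓝 (∑ l ∈ G, ‖fourierCoefficient μ f (toVec l)‖ ^ 2)) :=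
    tendsto_finsetSum _ (fun l _ =>
      (((hμ.tendsto_discreteCoefficient hR hB hs hfc hfs (toVec l)).comp hm).norm).pow 2)
  have h2 := hβ.mul ((hμ.tendsto_sum_norm_sq hR hB hs hfc hfs).comp hm)
  refine le_of_tendsto_of_tendsto h1 h2 ?_
  filter_upwards [eventually_subset_of_monotone hL hG] with k hk
  exact (Finset.sum_le_sum_of_subset_of_nonneg hk (fun _ _ _ => sq_nonneg _)).trans
    ((hsamp k).discreteCoefficient hB f).2

/-- The discrete lower bound is split over a fixed finite `G` and `L k \ G`. On `G` the discrete
coefficients converge; on the rest, their energy is controlled through `δ` by the approximation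
error and the tail of the convergent series. -/
theorem IsSelfAffineMeasure.lower_bound_of_hasSamplingBounds (hR : IsExpansive R)
    (hB : B.Nonempty) (hs : IsSimpleDigitSet R B) (hμ : IsSelfAffineMeasure R B μ)
    [IsProbabilityMeasure μ]
    (hm : Tendsto m atTop atTop) (hL : Monotone L)
    (hsamp : ∀ k, HasSamplingBounds R B (m k) (L k) (α k) (β k))
    (hα : Tendsto α atTop (𝓝 a)) (hβ : Tendsto β atTop (𝓝 b)) (hb : 0 ≤ b) (hδ : 0 < δ)
    (hLδ : ∀ k, ∀ l ∈ L k, δ ≤ ‖measureFourier μ ((invTransposeMap R ^ m k) (toVec l))‖ ^ 2)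
    {f : EuclideanSpace ℝ (Fin d) → ℂ} (hfc : Continuous f) (hfs : HasCompactSupport f) {s : ℝ}
    (hsum : HasSum ({l | ∃ k, l ∈ L k}.indicator
      (fun l => ‖fourierCoefficient μ f (toVec l)‖ ^ 2)) s) :
    a * ∫ x, ‖f x‖ ^ 2 ∂μ ≤ s := by
  classical
  set ψ : (Fin d → ℤ) → ℝ := {l | ∃ k, l ∈ L k}.indicator
    (fun l => ‖fourierCoefficient μ f (toVec l)‖ ^ 2) with hψ
  have hψ0 : ∀ l, 0 ≤ ψ l := fun l => Set.indicator_nonneg (fun _ _ => sq_nonneg _) l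
  have hψL : ∀ l, (∃ k, l ∈ L k) → ψ l = ‖fourierCoefficient μ f (toVec l)‖ ^ 2 :=
    fun l hl => Set.indicator_of_mem (s := {l | ∃ k, l ∈ L k}) hl _
  have key : ∀ η : ℝ, 0 < η →
      a * ∫ x, ‖f x‖ ^ 2 ∂μ ≤ s + δ⁻¹ * (2 * (b * η ^ 2 + η)) := by
    intro η hη
    -- The same `η` serves as tail size and as Riemann sum accuracy, whence the error `b * η ^ 2 +
    -- η`.
    obtain ⟨G0, hG0⟩ := (hsum.eventually_const_lt (show s - η < s by linarith)).exists
    set G := G0.filter (fun l => ∃ k, l ∈ L k) with hGdef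
    have hG : ∀ l ∈ G, ∃ k, l ∈ L k := fun l hl => (Finset.mem_filter.1 hl).2
    have hGsum : ∑ l ∈ G, ψ l = ∑ l ∈ G0, ψ l :=
      Finset.sum_filter_of_ne (fun l _ hl => by
        by_contra hcon
        exact hl (Set.indicator_of_notMem (s := {l | ∃ k, l ∈ L k}) hcon _))
    have h1 : Tendsto (fun k => ∑ l ∈ G, ‖discreteCoefficient R B f (m k) (toVec l)‖ ^ 2) atTop
        (𝓝 (∑ l ∈ G, ψ l)) :=
      tendsto_finsetSum _ (fun l hl => by
        rw [hψL l (hG l hl)]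
        exact (((hμ.tendsto_discreteCoefficient hR hB hs hfc hfs
          (toVec l)).comp hm).norm).pow 2)
    have h2 := hα.mul ((hμ.tendsto_sum_norm_sq hR hB hs hfc hfs).comp hm)
    have h3 : ∑ l ∈ G, ψ l ≤ s := sum_le_hasSum _ (fun l _ => hψ0 l) hsum
    refine (le_of_tendsto_of_tendsto h2 (h1.add_const (δ⁻¹ * (2 * (b * η ^ 2 + η)))) ?_).trans
      (by linarith)
    filter_upwards [eventually_subset_of_monotone hL hG,
      hm.eventually (hμ.eventually_sum_norm_sub_sq_le hR hB hs hfc hfs hb hη)] with k hk happ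
    refine ((hsamp k).discreteCoefficient hB f).1.trans ?_
    rw [← Finset.sum_sdiff hk, add_comm]
    refine add_le_add_right ?_ _
    have h4 := happ (L k \ G) (fun F => hμ.bessel_of_hasSamplingBounds hR hB hs hm hL hsamp hβ
      (fun l hl => ⟨k, (Finset.mem_sdiff.1 hl).1⟩) F)
    have h5 : ∑ l ∈ L k \ G, ‖fourierCoefficient μ f (toVec l)‖ ^ 2 ≤ η := by
      have h6 : ∑ l ∈ L k, ψ l ≤ s := sum_le_hasSum _ (fun l _ => hψ0 l) hsum
      rw [← Finset.sum_sdiff hk, hGsum] at h6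
      rw [← Finset.sum_congr rfl (fun l hl => hψL l ⟨k, (Finset.mem_sdiff.1 hl).1⟩)]
      linarith
    calc ∑ l ∈ L k \ G, ‖discreteCoefficient R B f (m k) (toVec l)‖ ^ 2
        ≤ ∑ l ∈ L k \ G, δ⁻¹ * (2 * (‖discreteCoefficient R B f (m k) (toVec l) *
          measureFourier μ ((invTransposeMap R ^ m k) (toVec l)) -
            fourierCoefficient μ f (toVec l)‖ ^ 2 + ‖fourierCoefficient μ f (toVec l)‖ ^ 2)) := by
          refine Finset.sum_le_sum (fun l hl => ?_)
          have h6 := hLδ k l (Finset.mem_sdiff.1 hl).1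
          set w := discreteCoefficient R B f (m k) (toVec l)
          set u := measureFourier μ ((invTransposeMap R ^ m k) (toVec l))
          set v := fourierCoefficient μ f (toVec l)
          rw [le_inv_mul_iff₀ hδ]
          -- Dividing out `μ̂` costs only `δ⁻¹`; the factor `2` comes from `(p + q)² ≤ 2(p² + q²)`.
          have h7 : δ * ‖w‖ ^ 2 ≤ ‖w * u‖ ^ 2 := by
            rw [norm_mul, mul_pow, mul_comm]
            exact mul_le_mul_of_nonneg_left h6 (sq_nonneg _)
          have h8 : ‖w * u‖ ≤ ‖w * u - v‖ + ‖v‖ := norm_le_norm_sub_add _ _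
          have h9 := pow_le_pow_left₀ (norm_nonneg _) h8 2
          nlinarith [sq_nonneg (‖w * u - v‖ - ‖v‖)]
      _ ≤ δ⁻¹ * (2 * (b * η ^ 2 + η)) := by
          rw [← Finset.mul_sum, ← Finset.mul_sum, Finset.sum_add_distrib]
          have := inv_pos.2 hδ
          gcongr
  have hlim : Tendsto (fun η : ℝ => s + δ⁻¹ * (2 * (b * η ^ 2 + η))) (𝓝[>] 0) (𝓝 s) := by
    have hc : Continuous (fun η : ℝ => s + δ⁻¹ * (2 * (b * η ^ 2 + η))) := by fun_prop
    have h0 := hc.tendsto 0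
    simp only [ne_eq, OfNat.ofNat_ne_zero, not_false_eq_true, zero_pow, mul_zero, add_zero] at h0
    exact h0.mono_left nhdsWithin_le_nhds
  exact ge_of_tendsto hlim (by
    filter_upwards [self_mem_nhdsWithin] with η hη
    exact key η hη)

theorem IsSelfAffineMeasure.exists_hasSum_of_hasSamplingBounds (hR : IsExpansive R)
    (hB : B.Nonempty) (hs : IsSimpleDigitSet R B) (hμ : IsSelfAffineMeasure R B μ)
    [IsProbabilityMeasure μ]
    (hm : Tendsto m atTop atTop) (hL : Monotone L)
    (hsamp : ∀ k, HasSamplingBounds R B (m k) (L k) (α k) (β k))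
    (hα : Tendsto α atTop (𝓝 a)) (hβ : Tendsto β atTop (𝓝 b)) (hb : 0 ≤ b) (hδ : 0 < δ)
    (hLδ : ∀ k, ∀ l ∈ L k, δ ≤ ‖measureFourier μ ((invTransposeMap R ^ m k) (toVec l))‖ ^ 2)
    (F : Lp ℂ 2 μ) :
    ∃ s, HasSum (fun l : ↥(toVec '' {l | ∃ k, l ∈ L k}) => ‖fourierCoefficient μ F l‖ ^ 2) s ∧
      a * ‖F‖ ^ 2 ≤ s ∧ s ≤ b * ‖F‖ ^ 2 := by
  set Λ : Set (Fin d → ℤ) := {l | ∃ k, l ∈ L k} with hΛ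
  set E : Λ → Lp ℂ 2 μ := fun l => expLp μ (toVec (l : Fin d → ℤ)) with hE
  have hbessel : ∀ F, ∀ G : Finset Λ, ∑ i ∈ G, ‖inner ℂ (E i) F‖ ^ 2 ≤ b * ‖F‖ ^ 2 := by
    intro F G
    have h1 := hμ.bessel_of_hasSamplingBounds hR hB hs hm hL hsamp hβ
      (G := G.map (Function.Embedding.subtype _)) (fun l hl => by
        obtain ⟨i, -, rfl⟩ := Finset.mem_map.1 hl
        exact i.2) F
    rwa [Finset.sum_map] at h1
  have hlower : ∀ F, a * ‖F‖ ^ 2 ≤ ∑' i, ‖inner ℂ (E i) F‖ ^ 2 := by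
    refine lower_bound_of_dense hbessel (dense_toLp_hasCompactSupport μ) ?_
    rintro _ ⟨f, hf, hfc, hfs, rfl⟩
    have hsum := (summable_of_bessel hbessel (hf.toLp f)).hasSum
    simp only [hE, inner_expLp, fourierCoefficient_toLp] at hsum ⊢
    rw [norm_toLp_sq]
    exact hμ.lower_bound_of_hasSamplingBounds hR hB hs hm hL hsamp hα hβ hb hδ hLδ hfc hfs
      ((hasSum_subtype_iff_indicator (s := Λ)
        (f := fun l => ‖fourierCoefficient μ f (toVec l)‖ ^ 2)).1 hsum)
  refine ⟨∑' i, ‖inner ℂ (E i) F‖ ^ 2, ?_, hlower F,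
    (summable_of_bessel hbessel F).tsum_le_of_sum_le (hbessel F)⟩
  rw [← (Equiv.Set.image toVec Λ toVec_injective).hasSum_iff]
  refine (summable_of_bessel hbessel F).hasSum.congr_fun (fun i => ?_)
  simp only [hE, inner_expLp]
  rfl

/-- Exponentials that form a Parseval frame of a probability measure are an orthonormal basis. -/
theorem IsParsevalFourierFrame.isSpectrum [IsProbabilityMeasure μ]
    {Λ : Set (EuclideanSpace ℝ (Fin d))} (h : IsParsevalFourierFrame μ Λ) : IsSpectrum μ Λ := by
  obtain ⟨b, hb⟩ := exists_hilbertBasis_of_parseval (E := fun l : Λ => expLp μ l)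
    (fun f => by simpa only [inner_expLp] using h f) (fun l => norm_expLp μ l)
  exact ⟨b, fun l => congrFun hb l⟩

end Frame

/-! ### Infinite products, the infimum `δ(Λ)`, and the final assembly -/

theorem tendsto_prod_one_add_of_summable {ε : ℕ → ℝ} (hε : Summable ε) :
    Tendsto (fun k => ∏ j ∈ Finset.range k, (1 + ε j)) atTop (𝓝 (∏' j, (1 + ε j))) :=
  (Real.multipliable_one_add_of_summable hε).hasProd.tendsto_prod_nat

theorem tprod_one_sub_pos {ε : ℕ → ℝ} (hε1 : ∀ k, ε k < 1) (hε : Summable ε) :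
    0 < ∏' j, (1 - ε j) := by
  simp only [sub_eq_add_neg]
  refine lt_of_le_of_ne (ge_of_tendsto' (tendsto_prod_one_add_of_summable hε.neg)
    (fun k => Finset.prod_nonneg (fun j _ => ?_))) (Ne.symm ?_)
  · have := hε1 j
    linarith
  · refine tprod_one_add_ne_zero_of_summable (fun j => ?_) hε.neg.norm
    have := hε1 j
    intro h
    linarith

theorem freqUnion_eq_image {d : ℕ} (R : Matrix (Fin d) (Fin d) ℤ) (n : ℕ → ℕ)
    (J : ℕ → Finset (Fin d → ℤ)) :
    freqUnion R n J = toVec '' {l | ∃ k, l ∈ freqSet R n J (k + 1)} := by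
  ext x
  simp only [freqUnion, Set.mem_iUnion, Set.mem_image, Finset.mem_coe, Set.mem_ofPred_eq]
  constructor
  · rintro ⟨k, l, hl, rfl⟩
    exact ⟨l, ⟨k, hl⟩, rfl⟩
  · rintro ⟨l, ⟨k, hl⟩, rfl⟩
    exact ⟨k, l, hl, rfl⟩

theorem deltaInf_le {d : ℕ} (μ : Measure (EuclideanSpace ℝ (Fin d)))
    (R : Matrix (Fin d) (Fin d) ℤ) (n : ℕ → ℕ) (J : ℕ → Finset (Fin d → ℤ)) (k : ℕ)
    {l : Fin d → ℤ} (hl : l ∈ freqSet R n J (k + 1)) :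
    deltaInf μ R n J ≤
      ‖measureFourier μ ((invTransposeMap R ^ partialLevel n (k + 1)) (toVec l))‖ ^ 2 := by
  -- A real infimum is a lower bound only for families bounded below; `0` serves for both infima.
  refine (ciInf_le ⟨0, ?_⟩ k).trans (ciInf_le (f := fun l : {l // l ∈ freqSet R n J (k + 1)} =>
    ‖measureFourier μ ((invTransposeMap R ^ partialLevel n (k + 1)) (toVec l.1))‖ ^ 2)
      ⟨0, ?_⟩ ⟨l, hl⟩)
  · rintro _ ⟨k, rfl⟩
    exact Real.iInf_nonneg (fun _ => sq_nonneg _)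
  · rintro _ ⟨l, rfl⟩
    exact sq_nonneg _

theorem mainTheorem11 {d : ℕ} {R : Matrix (Fin d) (Fin d) ℤ} (hR : IsExpansive R)
    {B : Finset (Fin d → ℤ)} (hB : B.Nonempty) (hsimple : IsSimpleDigitSet R B)
    (ε : ℕ → ℝ) (hε0 : ∀ k, 0 ≤ ε k) (hε1 : ∀ k, ε k < 1) (hεsum : Summable ε)
    (n : ℕ → ℕ) (hn : ∀ k, 0 < n k)
    (J : ℕ → Finset (Fin d → ℤ)) (hJ0 : ∀ k, 0 ∈ J k)
    (hJ : ∀ k, IsAlmostParseval R B (n k) (J k) (ε k))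
    (hδ : 0 < deltaInf (selfAffineMeasure hR hB) R n J) :
    (Multipliable (fun j => 1 - ε j) ∧ Multipliable (fun j => 1 + ε j) ∧
      IsFourierFrame (selfAffineMeasure hR hB) (freqUnion R n J)
        (∏' j, (1 - ε j)) (∏' j, (1 + ε j))) ∧
    ((∀ j, ε j = 0) →
      IsParsevalFourierFrame (selfAffineMeasure hR hB) (freqUnion R n J) ∧
      IsSpectrum (selfAffineMeasure hR hB) (freqUnion R n J)) := by
  have hμ := isSelfAffineMeasure_selfAffineMeasure hR hB
  have hδle := fun k l hl => deltaInf_le (selfAffineMeasure hR hB) R n J k (l := l) hl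
  set μ := selfAffineMeasure hR hB
  have hα : Tendsto (fun k => ∏ j ∈ Finset.range k, (1 - ε j)) atTop
      (𝓝 (∏' j, (1 - ε j))) := by
    simpa only [sub_eq_add_neg] using tendsto_prod_one_add_of_summable hεsum.neg
  have hβ := tendsto_prod_one_add_of_summable hεsum
  have hle : ∏' j, (1 - ε j) ≤ ∏' j, (1 + ε j) :=
    le_of_tendsto_of_tendsto' hα hβ (fun k => Finset.prod_le_prod
      (fun j _ => by have := hε1 j; linarith) (fun j _ => by have := hε0 j; linarith))
  have hpos := tprod_one_sub_pos hε1 hεsum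
  have hframe : ∀ F : Lp ℂ 2 μ, ∃ s,
      HasSum (fun l : freqUnion R n J => ‖fourierCoefficient μ F l‖ ^ 2) s ∧
        (∏' j, (1 - ε j)) * ‖F‖ ^ 2 ≤ s ∧ s ≤ (∏' j, (1 + ε j)) * ‖F‖ ^ 2 := by
    rw [freqUnion_eq_image]
    -- The shift to `k + 1` omits the trivial stage `{0}`, matching the range of `k` in `Λ` and
    -- `δ(Λ)`.
    exact hμ.exists_hasSum_of_hasSamplingBounds (m := fun k => partialLevel n (k + 1))
      (L := fun k => freqSet R n J (k + 1)) hR hB hsimple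
      ((tendsto_partialLevel hn).comp (tendsto_add_atTop_nat 1))
      (fun i j hij => freqSet_mono R n hJ0 (Nat.succ_le_succ hij))
      (fun k => (freqSet_hasSamplingBounds hR.isUnit_det hB hsimple hε0 hε1 hJ (k + 1)).2)
      (hα.comp (tendsto_add_atTop_nat 1)) (hβ.comp (tendsto_add_atTop_nat 1))
      (hpos.le.trans hle) hδ hδle
  refine ⟨⟨?_, Real.multipliable_one_add_of_summable hεsum, hpos, hle, fun F => ?_,
    fun F => ?_, fun F => ?_⟩, fun hε => ?_⟩
  · simpa only [sub_eq_add_neg] using Real.multipliable_one_add_of_summable hεsum.neg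
  · obtain ⟨s, hs, -, -⟩ := hframe F
    exact hs.summable
  · obtain ⟨s, hs, h1, -⟩ := hframe F
    rwa [hs.tsum_eq]
  · obtain ⟨s, hs, -, h2⟩ := hframe F
    rwa [hs.tsum_eq]
  · have hP : IsParsevalFourierFrame μ (freqUnion R n J) := by
      intro F
      obtain ⟨s, hs, h1, h2⟩ := hframe F
      -- Both products are `1`, so the two bounds pin the sum to `‖F‖ ^ 2`.
      simp only [hε, sub_zero, add_zero, tprod_one, one_mul] at h1 h2
      rwa [le_antisymm h2 h1] at hs
    exact ⟨hP, hP.isSpectrum⟩
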